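/- **Setting.** Let $d,T\ge 1$, let $\Lambda\in\mathbb R^{d\times d}$ be symmetric positive definite, and put $\Gamma:=(1+\tfrac1T)\Lambda+\tfrac1T\operatorname{tr}(\Lambda)I$. For in-context examples $(x_i,y_i)_{i=1}^n\subset\mathbb R^d\times\mathbb R$ and a query $x_{\rm q}\in\mathbb R^d$ let $E=\begin{pmatrix}x_1&\cdots&x_n&x_{\rm q}\\ y_1&\cdots&y_n&0\end{pmatrix}$. The linear self-attention model with parameters $\theta=(W^{KQ},W^{PV})$, two real $(d+1)\times(d+1)$ matrices, predicts by in-context learning (ICL) the label of $x_{\rm q}$ as the bottom-right entry of $E+W^{PV}E\,\frac{E^\top W^{KQ}E}{\rho}$, where $\rho=n$ is the number of examples (so $\rho=T$ in pretraining). *Pretraining.* Let $L(\theta)=\tfrac12\mathbb E\big[(\hat y_{\rm q}-\langle w,x_{\rm q}\rangle)^2\big]$, where $\hat y_{\rm q}$ is the prediction for $x_{\rm q}$ from the $T$ examples $(x_i,\langle w,x_i\rangle)$, and $w\sim N(0,I)$, $x_1,\dots,x_T,x_{\rm q}\sim N(0,\Lambda)$ are independent. Let $\theta(t)$, $t\ge0$,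 solve $\dot\theta=-\nabla L(\theta)$ with $W^{PV}(0)=\sigma\begin{pmatrix}0&0\\0&1\end{pmatrix}$ and $W^{KQ}(0)=\sigma\begin{pmatrix}\Theta\Theta^\top&0\\0&0\end{pmatrix}$, where $\sigma>0$, $\|\Theta\Theta^\top\|_F=1$, $\Theta\Lambda\ne0$ and $\sigma^2\|\Gamma\|_{op}\sqrt d<2$. *Fed-ICL.* Given client datasets $D^i=\{(x_n^i,y_n^i)\}_{n=1}^N$, $i=1,\dots,L$, and server covariates $x_1,\dots,x_M\in\mathbb R^d$ ($L,N,M\ge1$), all clients use the same model with parameter $\theta_*$. Put $y_{1,m}=0$ for all $m$. In round $k$, client $i$ first predicts by ICL from the examples $\{(x_m,y_{k,m})\}_{m=1}^M$ a label $\hat y_{k,n}^i$ for each $x_n^i$; it then predicts by ICL from the $2N$ examples $D^i$ and $\{(x_n^i,\hat y^i_{k,n})\}_{n=1}^N$ a label $y_{k+1,m}^i$ for each $x_m$. The server sets $y_{k+1,m}=\frac1L\sum_{i=1}^L y^i_{k+1,m}$. **Theorem.** The limit $\theta_*=\lim_{t\to\infty}\theta(t)$ exists, and for Fed-ICL with the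 pretrained model $\theta_*$ and any data as above the following holds. 1. There are $w_1=0,w_2,w_3,\dots\in\mathbb R^d$ such that at every round $k\ge1$ we have $y_{k,m}=w_k^\top x_m$ for all $m\in\{1,\dots,M\}$, and $$w_{k+1}=\tfrac12H_{\rm cont}w_k+\tfrac12w_{\rm limit},$$ where $$H_{\rm cont}=\frac{\Gamma^{-1}\big(\sum_{i=1}^L\sum_{n=1}^N x_n^i(x_n^i)^\top\big)\Gamma^{-1}\sum_{m=1}^M x_mx_m^\top}{NML},\qquad w_{\rm limit}=\Gamma^{-1}\,\frac{\sum_{i=1}^L\sum_{n=1}^N x_n^iy_n^i}{NL}.$$ 2. For every $x\in\mathbb R^d$, the label that the model $\theta_*$ predicts for the query $x$ by ICL from the $LN$ examples of $D^1,\dots,D^L$ together is $w_{\rm limit}^\top x$. -/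

import Mathlib

open MeasureTheory ProbabilityTheory Filter Topology Matrix

noncomputable section

namespace FedICL

/-- Index set of the `d + 1` rows of an embedding: `d` coordinates of the covariate, then the
label. -/
abbrev Tok (d : ℕ) : Type := Fin d ⊕ Unit

/-- A parameter `θ = (W^{KQ}, W^{PV})` of a single-layer linear self-attention model: two real
`(d+1) × (d+1)` matrices, with the Euclidean inner product of their entries. The left summand
indexes the entries of `W^{KQ}`, the right one those of `W^{PV}`. -/
abbrev Params (d : ℕ) : Type := EuclideanSpace ℝ ((Tok d × Tok d) ⊕ (Tok d × Tok d))

namespace Params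

variable {d : ℕ}

/-- The merged key-query matrix. -/
def KQ (θ : Params d) : Matrix (Tok d) (Tok d) ℝ := Matrix.of fun a b => θ (Sum.inl (a, b))

/-- The merged projection-value matrix. -/
def PV (θ : Params d) : Matrix (Tok d) (Tok d) ℝ := Matrix.of fun a b => θ (Sum.inr (a, b))

/-- The parameter with the given pair of matrices. -/
def ofMatrices (kq pv : Matrix (Tok d) (Tok d) ℝ) : Params d :=
  WithLp.toLp 2 (Sum.elim (fun p => kq p.1 p.2) (fun p => pv p.1 p.2))

end Params

section Model

variable {d : ℕ} {ι : Type*} [Fintype ι]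

/-- The embedding matrix of a prompt: one column `(xᵢ, yᵢ)` for each in-context example, and a
last column `(x_query, 0)`. The examples are indexed by an arbitrary finite type. -/
def embedding (ex : ι → (Fin d → ℝ) × ℝ) (xq : Fin d → ℝ) : Matrix (Tok d) (ι ⊕ Unit) ℝ :=
  Matrix.fromBlocks
    (Matrix.of fun a i => (ex i).1 a) (Matrix.of fun a _ => xq a)
    (Matrix.of fun _ i => (ex i).2) 0

/-- The linear self-attention layer `E + W^{PV} E (Eᵀ W^{KQ} E) / ρ`. -/
def lsa (ρ : ℝ) (θ : Params d) (E : Matrix (Tok d) (ι ⊕ Unit) ℝ) : Matrix (Tok d) (ι ⊕ Unit) ℝ :=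
  E + ρ⁻¹ • (θ.PV * E * (Eᵀ * θ.KQ * E))

/-- In-context prediction for the query `xq`: the entry of the output of the layer in the label
row and the query column. The normalization `ρ` is the number of in-context examples. -/
def icl (θ : Params d) (ex : ι → (Fin d → ℝ) × ℝ) (xq : Fin d → ℝ) : ℝ :=
  lsa (Fintype.card ι : ℝ) θ (embedding ex xq) (Sum.inr ()) (Sum.inr ())

end Model

section Pretraining

variable {d : ℕ}

/-- The law of a pretraining task with prompts of length `T`: the task weight `w ∼ N(0, I)`, the
covariates `x₁, …, x_T ∼ N(0, Λ)` and the query covariate `x_query ∼ N(0, Λ)`, all independent. -/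
def taskLaw (Λ : Matrix (Fin d) (Fin d) ℝ) (T : ℕ) :
    Measure (EuclideanSpace ℝ (Fin d) ×
      ((Fin T → EuclideanSpace ℝ (Fin d)) × EuclideanSpace ℝ (Fin d))) :=
  (multivariateGaussian 0 1).prod
    ((Measure.pi fun _ : Fin T => multivariateGaussian 0 Λ).prod (multivariateGaussian 0 Λ))

/-- The population loss `½ E[(ŷ_query - ⟨w, x_query⟩)²]`; the training prompt has the `T` examples
`(xᵢ, ⟨w, xᵢ⟩)`, so that the normalization of the model is `ρ = T`. -/
def populationLoss (Λ : Matrix (Fin d) (Fin d) ℝ) (T : ℕ) (θ : Params d) : ℝ :=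
  (1 / 2) * ∫ p, (icl θ (fun i : Fin T => ((p.2.1 i).ofLp, inner ℝ p.1 (p.2.1 i))) p.2.2.ofLp
    - inner ℝ p.1 p.2.2) ^ 2 ∂(taskLaw Λ T)

/-- `θ` solves `dθ/dt = -∇F(θ)` for all times `t ≥ 0`. -/
def IsGradientFlow (F : Params d → ℝ) (θ : ℝ → Params d) : Prop :=
  ∀ t : ℝ, 0 ≤ t → HasDerivWithinAt θ (-gradient F (θ t)) (Set.Ici 0) t

/-- `Γ = (1 + 1/T) Λ + (1/T) tr(Λ) I`. -/
def Gam (Λ : Matrix (Fin d) (Fin d) ℝ) (T : ℕ) : Matrix (Fin d) (Fin d) ℝ :=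
  (1 + 1 / (T : ℝ)) • Λ + (1 / (T : ℝ) * Λ.trace) • (1 : Matrix (Fin d) (Fin d) ℝ)

/-- Frobenius norm. -/
def frobNorm (A : Matrix (Fin d) (Fin d) ℝ) : ℝ := √(∑ i, ∑ j, A i j ^ 2)

/-- Euclidean operator norm. -/
def opNorm (A : Matrix (Fin d) (Fin d) ℝ) : ℝ := ‖Matrix.toEuclideanCLM (𝕜 := ℝ) A‖

/-- The initialization of pretraining, with scale `σ` and matrix `Θ`. -/
def initParams (σ : ℝ) (Θ : Matrix (Fin d) (Fin d) ℝ) : Params d :=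
  Params.ofMatrices (σ • Matrix.fromBlocks (Θ * Θᵀ) 0 0 0) (σ • Matrix.fromBlocks 0 0 0 1)

end Pretraining

section Algorithm

variable {d L N M : ℕ}

/-- Step 1 of a round on a client with examples `D`: the labels that the client's model predicts
for its own covariates, with the server's query dataset `C` as in-context examples. -/
def relabel (θ : Params d) (D : Fin N → (Fin d → ℝ) × ℝ) (C : Fin M → (Fin d → ℝ) × ℝ) :
    Fin N → (Fin d → ℝ) × ℝ :=
  fun n => ((D n).1, icl θ C (D n).1)

/-- Step 2 of a round on a client with examples `D`: the labels that the client's model predicts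
for the server's covariates, with `D` and the relabelled `D` together (`2N` examples) as
in-context examples. -/
def clientAnswer (θ : Params d) (D : Fin N → (Fin d → ℝ) × ℝ) (C : Fin M → (Fin d → ℝ) × ℝ) :
    Fin M → ℝ :=
  fun m => icl θ (Sum.elim D (relabel θ D C)) (C m).1

/-- One round of Fed-ICL with average aggregation: from the server labels `y` to the next ones. -/
def fedRound (θ : Params d) (D : Fin L → Fin N → (Fin d → ℝ) × ℝ) (x : Fin M → Fin d → ℝ)
    (y : Fin M → ℝ) : Fin M → ℝ :=
  fun m => (1 / (L : ℝ)) * ∑ i, clientAnswer θ (D i) (fun m' => (x m', y m')) m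

/-- Server labels of Fed-ICL started from zero labels: `serverLabels θ D x j` are the labels after
`j` completed rounds, that is, the labels `y_{j+1}` at the start of round `j + 1`. -/
def serverLabels (θ : Params d) (D : Fin L → Fin N → (Fin d → ℝ) × ℝ) (x : Fin M → Fin d → ℝ) :
    ℕ → Fin M → ℝ
  | 0 => 0
  | j + 1 => fedRound θ D x (serverLabels θ D x j)

/-- `H_cont = Γ⁻¹ (∑_{i,n} x_n^i (x_n^i)ᵀ) Γ⁻¹ (∑_m x_m x_mᵀ) / (N M L)`. -/
def Hcont (Γ : Matrix (Fin d) (Fin d) ℝ) (D : Fin L → Fin N → (Fin d → ℝ) × ℝ)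
    (x : Fin M → Fin d → ℝ) : Matrix (Fin d) (Fin d) ℝ :=
  (1 / ((N : ℝ) * M * L)) •
    (Γ⁻¹ * (∑ i, ∑ n, vecMulVec (D i n).1 (D i n).1) * Γ⁻¹ * ∑ m, vecMulVec (x m) (x m))

/-- `w_limit = Γ⁻¹ (∑_{i,n} x_n^i y_n^i) / (N L)`. -/
def wLimit (Γ : Matrix (Fin d) (Fin d) ℝ) (D : Fin L → Fin N → (Fin d → ℝ) × ℝ) : Fin d → ℝ :=
  Γ⁻¹ *ᵥ ((1 / ((N : ℝ) * L)) • ∑ i, ∑ n, (D i n).2 • (D i n).1)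

/-- All client datasets put together, as one family of `L N` examples. -/
def pooled (D : Fin L → Fin N → (Fin d → ℝ) × ℝ) : Fin L × Fin N → (Fin d → ℝ) × ℝ :=
  fun p => D p.1 p.2

end Algorithm

end FedICL

end

/-! Negating all labels amounts to changing the sign of the off-diagonal blocks of both weight
matrices. Since `w` and `-w` have the same law, the loss is invariant under this reflection
(`populationLoss_signFlip`). The initialization is fixed by it, so uniqueness for the ODE keeps the
whole trajectory block diagonal.

On block diagonal parameters the loss sees only the value entry `s` and the covariate block `A` of
the key-query matrix. Gaussian fourth moments give `E[S²] = ΛΓ` for the empirical covariance `S`.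
Completing the square then turns the loss into `½⟪K(sA - Γ⁻¹), sA - Γ⁻¹⟫` plus a constant, with `K :
A ↦ ΛΓAΛ` positive definite.

The flow of this quadratic conserves `‖A‖² - s²`, which vanishes initially. The initial loss lies
below the loss at zero (`initial_loss_lt`), and together with balance this keeps `s` away from `0`.
A Polyak–Łojasiewicz inequality then yields exponential decay, so `sA → Γ⁻¹`. Balance also forces
`s² = ‖sA‖`, hence `s` and `A` converge separately (`exists_tendsto_of_balanced_flow`).

The limiting model therefore predicts by applying `Γ⁻¹` to the average of the label-weighted
covariates. This is linear in the labels, so both steps of a Fed-ICL round map linear labelings to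
linear ones, and the recursion is matrix algebra (`fedRound_eq`). -/

namespace FedICL

/-! ### Functions with finite moments of all orders -/

section Moments

variable {Ω : Type*} {mΩ : MeasurableSpace Ω} {μ : Measure Ω}

/-- All moments of `f` are finite. -/
def AllMoments (f : Ω → ℝ) (μ : Measure Ω) : Prop := ∀ n : ℕ, MemLp f n μ

namespace AllMoments

variable {f g : Ω → ℝ}

theorem integrable (hf : AllMoments f μ) : Integrable f μ := by
  rw [← memLp_one_iff_integrable]
  simpa using hf 1

/-- Hölder with exponents `2n, 2n`. Closure under products makes every polynomial in the Gaussian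
data integrable. -/
theorem mul (hf : AllMoments f μ) (hg : AllMoments g μ) :
    AllMoments (fun ω => f ω * g ω) μ := by
  intro n
  have : ENNReal.HolderTriple ((2 * n : ℕ) : ENNReal) ((2 * n : ℕ) : ENNReal) (n : ENNReal) := by
    constructor
    rcases Nat.eq_zero_or_pos n with rfl | hn
    · simp
    · push_cast
      rw [ENNReal.mul_inv (by simp) (by simp), ← add_mul, ENNReal.inv_two_add_inv_two, one_mul]
  exact MemLp.mul' (p := ((2 * n : ℕ) : ENNReal)) (q := ((2 * n : ℕ) : ENNReal))
    (hg (2 * n)) (hf (2 * n))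

theorem const [IsFiniteMeasure μ] (c : ℝ) : AllMoments (fun _ : Ω => c) μ :=
  fun _ => memLp_const c

theorem add (hf : AllMoments f μ) (hg : AllMoments g μ) :
    AllMoments (fun ω => f ω + g ω) μ := fun n => (hf n).add (hg n)

theorem sub (hf : AllMoments f μ) (hg : AllMoments g μ) :
    AllMoments (fun ω => f ω - g ω) μ := fun n => (hf n).sub (hg n)

theorem const_mul (c : ℝ) (hf : AllMoments f μ) :
    AllMoments (fun ω => c * f ω) μ := fun n => (hf n).const_mul c

theorem sum {ι : Type*} (s : Finset ι) {F : ι → Ω → ℝ} (hF : ∀ i ∈ s, AllMoments (F i) μ) :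
    AllMoments (fun ω => ∑ i ∈ s, F i ω) μ := fun n => memLp_finsetSum s fun i hi => hF i hi n

theorem integral_sub (hf : AllMoments f μ) (hg : AllMoments g μ) :
    ∫ ω, (f ω - g ω) ∂μ = ∫ ω, f ω ∂μ - ∫ ω, g ω ∂μ :=
  MeasureTheory.integral_sub hf.integrable hg.integrable

theorem integral_sum {ι : Type*} (s : Finset ι) {F : ι → Ω → ℝ}
    (hF : ∀ i ∈ s, AllMoments (F i) μ) :
    ∫ ω, ∑ i ∈ s, F i ω ∂μ = ∑ i ∈ s, ∫ ω, F i ω ∂μ :=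
  integral_finsetSum s fun i hi => (hF i hi).integrable

theorem pow [IsFiniteMeasure μ] (hf : AllMoments f μ) (k : ℕ) :
    AllMoments (fun ω => f ω ^ k) μ := by
  induction k with
  | zero => simpa using const 1
  | succ k ih => simpa only [pow_succ] using ih.mul hf

theorem comp_measurePreserving {Ω' : Type*} {mΩ' : MeasurableSpace Ω'} {ν : Measure Ω'}
    {φ : Ω' → Ω} (hf : AllMoments f μ) (hφ : MeasurePreserving φ ν μ) :
    AllMoments (fun ω => f (φ ω)) ν := fun n => (hf n).comp_measurePreserving hφ

end AllMoments

end Moments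

/-! ### Second and fourth moments of Gaussian vectors -/

section GaussianMoments

/-- The fourth moment is the fourth derivative at `0` of the moment generating function `exp (c t² /
2)`. -/
theorem integral_pow_four_gaussianReal (v : NNReal) :
    ∫ x, x ^ 4 ∂(gaussianReal 0 v) = 3 * (v : ℝ) ^ 2 := by
  have h := iteratedDeriv_mgf_zero (X := fun x : ℝ => x) (μ := gaussianReal 0 v)
    (by simp) 4
  have h0 : (∫ x, x ^ 4 ∂(gaussianReal 0 v)) =
      iteratedDeriv 4 (mgf (fun x : ℝ => x) (gaussianReal 0 v)) 0 := by
    rw [h]; rfl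
  rw [h0, mgf_fun_id_gaussianReal]
  set c : ℝ := (v : ℝ)
  have e : ∀ t : ℝ, HasDerivAt (fun t : ℝ => Real.exp (0 * t + c * t ^ 2 / 2))
      (Real.exp (0 * t + c * t ^ 2 / 2) * (c * t)) t := by
    intro t
    have : HasDerivAt (fun t : ℝ => 0 * t + c * t ^ 2 / 2) (c * t) t := by
      exact (((hasDerivAt_id' t).const_mul 0).fun_add
        ((((hasDerivAt_id' t).fun_pow 2).const_mul c).div_const 2)).congr_deriv (by simp; ring)
    exact this.exp
  -- Differentiation sends `exp · p` to `exp · (c t p + p')`, so only polynomial factors need to be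
  -- tracked.
  have step : ∀ (p q : ℝ → ℝ) , (∀ t, HasDerivAt p (q t) t) →
      deriv (fun t => Real.exp (0 * t + c * t ^ 2 / 2) * p t) =
        fun t => Real.exp (0 * t + c * t ^ 2 / 2) * (c * t * p t + q t) := by
    intro p q hp
    funext t
    rw [((e t).fun_mul (hp t)).deriv]
    ring
  have d1 : deriv (fun t => Real.exp (0 * t + c * t ^ 2 / 2)) =
      fun t => Real.exp (0 * t + c * t ^ 2 / 2) * (c * t) := funext fun t => (e t).deriv
  have p1 : ∀ t : ℝ, HasDerivAt (fun t : ℝ => c * t) c t := fun t => by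
    simpa using (hasDerivAt_id t).const_mul c
  have p2 : ∀ t : ℝ, HasDerivAt (fun t : ℝ => c * t * (c * t) + c) (2 * c ^ 2 * t) t := fun t => by
    exact (((p1 t).fun_mul (p1 t)).add_const c).congr_deriv (by ring)
  have p3 : ∀ t : ℝ, HasDerivAt (fun t : ℝ => c * t * (c * t * (c * t) + c) + 2 * c ^ 2 * t)
      (3 * c ^ 3 * t ^ 2 + 3 * c ^ 2) t := fun t => by
    exact (((p1 t).fun_mul (p2 t)).fun_add
      ((hasDerivAt_id' t).const_mul (2 * c ^ 2))).congr_deriv (by ring)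
  simp only [iteratedDeriv_succ, iteratedDeriv_zero]
  rw [d1, step _ _ p1, step _ _ p2, step _ _ p3]
  simp

variable {d : ℕ} {S : Matrix (Fin d) (Fin d) ℝ}

theorem allMoments_strongDual (ν : Measure (EuclideanSpace ℝ (Fin d))) [IsGaussian ν]
    (l : StrongDual ℝ (EuclideanSpace ℝ (Fin d))) : AllMoments (fun x => l x) ν :=
  fun n => IsGaussian.memLp_dual ν l n (by simp)

theorem allMoments_coord (ν : Measure (EuclideanSpace ℝ (Fin d))) [IsGaussian ν] (a : Fin d) :
    AllMoments (fun x => x a) ν :=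
  allMoments_strongDual ν (EuclideanSpace.proj a)

theorem integral_coord_multivariateGaussian (a : Fin d) :
    ∫ x, x a ∂(multivariateGaussian (0 : EuclideanSpace ℝ (Fin d)) S) = 0 := by
  have := IsGaussian.integral_dual (μ := multivariateGaussian (0 : EuclideanSpace ℝ (Fin d)) S)
    (EuclideanSpace.proj a)
  simpa using this

theorem integral_coord_mul_coord_multivariateGaussian (hS : S.PosSemidef) (a b : Fin d) :
    ∫ x, x a * x b ∂(multivariateGaussian (0 : EuclideanSpace ℝ (Fin d)) S) = S a b := by
  have h := covariance_eval_multivariateGaussian (μ := 0) hS a b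
  rw [covariance_eq_sub (by simpa using allMoments_coord _ a 2) (by simpa using allMoments_coord _ b 2)]
    at h
  simpa [integral_coord_multivariateGaussian] using h

/-- The linear form with coefficient vector `u`. -/
noncomputable def coordForm (u : Fin d → ℝ) : StrongDual ℝ (EuclideanSpace ℝ (Fin d)) :=
  ∑ a, u a • EuclideanSpace.proj a

theorem coordForm_apply (u : Fin d → ℝ) (x : EuclideanSpace ℝ (Fin d)) :
    coordForm u x = ∑ a, u a * x a := by
  simp [coordForm]

theorem integral_coordForm_sq (hS : S.PosSemidef) (u : Fin d → ℝ) :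
    ∫ x, coordForm u x ^ 2 ∂(multivariateGaussian (0 : EuclideanSpace ℝ (Fin d)) S) =
      u ⬝ᵥ S *ᵥ u := by
  simp_rw [coordForm_apply, sq, Finset.sum_mul_sum]
  rw [integral_finsetSum _ fun i _ => (AllMoments.sum _ fun j _ =>
    ((allMoments_coord _ i).const_mul _).mul ((allMoments_coord _ j).const_mul _)).integrable]
  simp only [dotProduct, mulVec, Finset.mul_sum]
  refine Finset.sum_congr rfl fun i _ => ?_
  rw [integral_finsetSum _ fun j _ =>
    (((allMoments_coord _ i).const_mul _).mul ((allMoments_coord _ j).const_mul _)).integrable]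
  refine Finset.sum_congr rfl fun j _ => ?_
  rw [← integral_coord_mul_coord_multivariateGaussian hS i j, mul_comm _ (u j),
    ← integral_const_mul, ← integral_const_mul]
  congr 1; funext x; ring

/-- The law of a linear form of a Gaussian vector is a real Gaussian, here of variance `u ⬝ᵥ S *ᵥ
u`. -/
theorem integral_coordForm_pow_four (hS : S.PosSemidef) (u : Fin d → ℝ) :
    ∫ x, coordForm u x ^ 4 ∂(multivariateGaussian (0 : EuclideanSpace ℝ (Fin d)) S) =
      3 * (u ⬝ᵥ S *ᵥ u) ^ 2 := by
  have hmap := IsGaussian.map_eq_gaussianReal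
    (μ := multivariateGaussian (0 : EuclideanSpace ℝ (Fin d)) S) (coordForm u)
  have hmean : ∫ x, coordForm u x ∂(multivariateGaussian (0 : EuclideanSpace ℝ (Fin d)) S) = 0 := by
    rw [IsGaussian.integral_dual]; simp
  have hvar : Var[coordForm u; multivariateGaussian (0 : EuclideanSpace ℝ (Fin d)) S] =
      u ⬝ᵥ S *ᵥ u := by
    rw [variance_of_integral_eq_zero (coordForm u).continuous.aemeasurable hmean,
      integral_coordForm_sq hS]
  rw [hmean, hvar] at hmap
  have h := integral_map (μ := multivariateGaussian (0 : EuclideanSpace ℝ (Fin d)) S)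
    (φ := coordForm u) (f := fun x : ℝ => x ^ 4) (coordForm u).continuous.aemeasurable
    (by fun_prop)
  rw [← h, hmap, integral_pow_four_gaussianReal, Real.coe_toNNReal]
  simpa using hS.dotProduct_mulVec_nonneg u

/-- **Isserlis' theorem** for the fourth mixed moments of a centred Gaussian vector. -/
theorem integral_four_coords_multivariateGaussian (hS : S.PosSemidef) (a b c e : Fin d) :
    ∫ x, x a * x b * x c * x e ∂(multivariateGaussian (0 : EuclideanSpace ℝ (Fin d)) S) =
      S a b * S c e + S a c * S b e + S a e * S b c := by
  set ν := multivariateGaussian (0 : EuclideanSpace ℝ (Fin d)) S with hν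
  let v (p q r : ℝ) : Fin d → ℝ :=
    Pi.single a 1 + p • Pi.single b 1 + q • Pi.single c 1 + r • Pi.single e 1
  have hv (p q r : ℝ) (x : EuclideanSpace ℝ (Fin d)) :
      coordForm (v p q r) x = x a + p * x b + q * x c + r * x e := by
    simp [coordForm_apply, v, add_mul, Finset.sum_add_distrib, Pi.single_apply]
  have hsymm : ∀ i j, S i j = S j i := fun i j => by
    have := hS.1.apply i j; simpa using this.symm
  have hQ (p q r : ℝ) : v p q r ⬝ᵥ S *ᵥ v p q r =
      S a a + p ^ 2 * S b b + q ^ 2 * S c c + r ^ 2 * S e e + 2 * p * S a b + 2 * q * S a c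
        + 2 * r * S a e + 2 * p * q * S b c + 2 * p * r * S b e + 2 * q * r * S c e := by
    simp only [v, mulVec_add, mulVec_smul, add_dotProduct, dotProduct_add, smul_dotProduct,
      dotProduct_smul, mulVec_single_one, single_one_dotProduct, smul_eq_mul, Matrix.col_apply]
    rw [hsymm b a, hsymm c a, hsymm e a, hsymm c b, hsymm e b, hsymm e c]
    ring
  have hI (p q r : ℝ) : ∫ x, (x a + p * x b + q * x c + r * x e) ^ 4 ∂ν =
      3 * (S a a + p ^ 2 * S b b + q ^ 2 * S c c + r ^ 2 * S e e + 2 * p * S a b + 2 * q * S a c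
        + 2 * r * S a e + 2 * p * q * S b c + 2 * p * r * S b e + 2 * q * r * S c e) ^ 2 := by
    rw [← hQ, ← integral_coordForm_pow_four hS]
    simp_rw [hv]
    rfl
  have hint (p q r : ℝ) : AllMoments (fun x : EuclideanSpace ℝ (Fin d) =>
      (x a + p * x b + q * x c + r * x e) ^ 4) ν :=
    ((((allMoments_coord ν a).add ((allMoments_coord ν b).const_mul p)).add
      ((allMoments_coord ν c).const_mul q)).add ((allMoments_coord ν e).const_mul r)).pow 4
  -- Polarization: weighting by the product of the three signs leaves only the monomial odd in each
  -- of `b`, `c`, `e`. It has coefficient `4! = 24` in each of the 8 powers, whence `192`.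
  have hpol : ∀ x : EuclideanSpace ℝ (Fin d), x a * x b * x c * x e =
      (1 / 192) * ((((x a + 1 * x b + 1 * x c + 1 * x e) ^ 4
        - (x a + 1 * x b + 1 * x c + (-1) * x e) ^ 4)
        - ((x a + 1 * x b + (-1) * x c + 1 * x e) ^ 4
        - (x a + 1 * x b + (-1) * x c + (-1) * x e) ^ 4))
        - (((x a + (-1) * x b + 1 * x c + 1 * x e) ^ 4
        - (x a + (-1) * x b + 1 * x c + (-1) * x e) ^ 4)
        - ((x a + (-1) * x b + (-1) * x c + 1 * x e) ^ 4
        - (x a + (-1) * x b + (-1) * x c + (-1) * x e) ^ 4))) := fun x => by ring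
  simp_rw [hpol]
  have h2 (p q : ℝ) := (hint p q 1).integral_sub (hint p q (-1))
  have h4 (p : ℝ) := ((hint p 1 1).sub (hint p 1 (-1))).integral_sub
    ((hint p (-1) 1).sub (hint p (-1) (-1)))
  have h8 := (((hint 1 1 1).sub (hint 1 1 (-1))).sub
    ((hint 1 (-1) 1).sub (hint 1 (-1) (-1)))).integral_sub
    (((hint (-1) 1 1).sub (hint (-1) 1 (-1))).sub ((hint (-1) (-1) 1).sub (hint (-1) (-1) (-1))))
  rw [integral_const_mul, h8, h4, h4, h2, h2, h2, h2]
  simp only [hI]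
  ring

end GaussianMoments
-- Convergence of the balanced two-factor gradient flow
section AbstractFlow

theorem antitoneOn_Ici_of_hasDerivWithinAt {f f' : ℝ → ℝ}
    (hf : ∀ t, 0 ≤ t → HasDerivWithinAt f (f' t) (Set.Ici 0) t) (hf' : ∀ t, 0 ≤ t → f' t ≤ 0) :
    AntitoneOn f (Set.Ici 0) := by
  refine antitoneOn_of_hasDerivWithinAt_nonpos (f' := f') (convex_Ici 0)
    (fun t ht => (hf t ht).continuousWithinAt) (fun t ht => ?_) (fun t ht => ?_)
  · exact (hf t (interior_subset ht)).mono interior_subset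
  · exact hf' t (interior_subset ht)

theorem eq_of_hasDerivWithinAt_Ici_zero {f : ℝ → ℝ}
    (hf : ∀ t, 0 ≤ t → HasDerivWithinAt f 0 (Set.Ici 0) t) {t : ℝ} (ht : 0 ≤ t) : f t = f 0 := by
  refine le_antisymm (antitoneOn_Ici_of_hasDerivWithinAt hf (fun _ _ => le_rfl) Set.self_mem_Ici ht ht) ?_
  have := antitoneOn_Ici_of_hasDerivWithinAt (f := fun t => - f t) (f' := fun _ => - 0)
    (fun t ht => (hf t ht).fun_neg) (by simp) Set.self_mem_Ici ht ht
  simpa using this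

open scoped RealInnerProductSpace

variable {E : Type*} [NormedAddCommGroup E] [InnerProductSpace ℝ E]

/-- Gradient flow of `(A, s) ↦ ½ ⟪K (s A - G), s A - G⟫` for a positive definite `K`, started
from a balanced point whose loss is smaller than the loss at the origin. -/
theorem exists_tendsto_of_balanced_flow {K : E →L[ℝ] E} (hK : ∀ x y, ⟪K x, y⟫ = ⟪x, K y⟫)
    {k : ℝ} (hk : 0 < k) (hpos : ∀ x, ‖x‖ ^ 2 ≤ k * ⟪K x, x⟫) {G : E} {A : ℝ → E} {s : ℝ → ℝ}
    (hA : ∀ t, 0 ≤ t → HasDerivWithinAt A (-(s t • K (s t • A t - G))) (Set.Ici 0) t)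
    (hs : ∀ t, 0 ≤ t → HasDerivWithinAt s (-⟪K (s t • A t - G), A t⟫) (Set.Ici 0) t)
    (hs0 : 0 < s 0) (hbal : ‖A 0‖ = s 0)
    (hloss : ⟪K (s 0 • A 0 - G), s 0 • A 0 - G⟫ < ⟪K G, G⟫) :
    ∃ (A' : E) (s' : ℝ), Tendsto A atTop (𝓝 A') ∧ Tendsto s atTop (𝓝 s') ∧ s' • A' = G := by
  set Z : ℝ → E := fun t => s t • A t - G with hZ
  set q : ℝ → ℝ := fun t => ⟪K (Z t), Z t⟫ with hq
  -- Both `‖A‖²` and `s²` have derivative `-2 s ⟪K Z, A⟫`, so their difference is conserved.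
  have hbalance : ∀ t, 0 ≤ t → ‖A t‖ ^ 2 = s t ^ 2 := by
    intro t ht
    have h := eq_of_hasDerivWithinAt_Ici_zero (f := fun t => ⟪A t, A t⟫ - s t ^ 2)
      (fun t ht => (((hA t ht).inner ℝ (hA t ht)).fun_sub ((hs t ht).fun_pow 2)).congr_deriv (by
        simp only [inner_neg_left, inner_neg_right, real_inner_smul_left, real_inner_smul_right]
        rw [real_inner_comm (K _) (A t)]
        push_cast; ring)) ht
    simp only [real_inner_self_eq_norm_sq] at h
    rw [hbal] at h
    linarith
  have hqnn : ∀ t, 0 ≤ q t := fun t => by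
    have := hpos (Z t)
    by_contra hneg
    push Not at hneg
    nlinarith [sq_nonneg ‖Z t‖, mul_pos_of_neg_of_neg hneg (neg_neg_of_pos hk)]
  -- Polyak–Łojasiewicz inequality: Cauchy–Schwarz and coercivity give `q² ≤ ‖K Z‖² ‖Z‖² ≤ ‖K Z‖² k
  -- q`.
  have hqle : ∀ t, q t ≤ k * ‖K (Z t)‖ ^ 2 := by
    intro t
    have h1 : q t ≤ ‖K (Z t)‖ * ‖Z t‖ := real_inner_le_norm _ _
    have h2 := hpos (Z t)
    have h3 := hqnn t
    have h4 : q t ^ 2 ≤ ‖K (Z t)‖ ^ 2 * (k * q t) := by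
      calc q t ^ 2 ≤ (‖K (Z t)‖ * ‖Z t‖) ^ 2 := by gcongr
        _ = ‖K (Z t)‖ ^ 2 * ‖Z t‖ ^ 2 := by ring
        _ ≤ _ := by gcongr
    rcases h3.eq_or_lt with h0 | h0
    · rw [← h0]; positivity
    · nlinarith
  have hZd : ∀ t, 0 ≤ t → HasDerivWithinAt Z
      (s t • (-(s t • K (Z t))) + (-⟪K (Z t), A t⟫) • A t) (Set.Ici 0) t := fun t ht =>
    ((hs t ht).fun_smul (hA t ht)).sub_const G
  have hqd : ∀ t, 0 ≤ t → HasDerivWithinAt q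
      (-(2 * (⟪K (Z t), A t⟫ ^ 2 + s t ^ 2 * ‖K (Z t)‖ ^ 2))) (Set.Ici 0) t := by
    intro t ht
    refine ((K.hasFDerivAt.comp_hasDerivWithinAt t (hZd t ht)).inner ℝ (hZd t ht)).congr_deriv ?_
    have hswap : ∀ v, ⟪K v, Z t⟫ = ⟪K (Z t), v⟫ := fun v => by rw [hK, real_inner_comm]
    rw [Function.comp, hswap (_ + _)]
    simp only [inner_neg_right, inner_add_right, real_inner_smul_right, smul_neg,
      real_inner_self_eq_norm_sq]
    ring
  have hqanti : ∀ t, 0 ≤ t → q t ≤ q 0 := fun t ht =>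
    antitoneOn_Ici_of_hasDerivWithinAt hqd (fun t _ => by
      have : 0 ≤ ⟪K (Z t), A t⟫ ^ 2 + s t ^ 2 * ‖K (Z t)‖ ^ 2 := by positivity
      linarith) Set.self_mem_Ici ht ht
  set c : ℝ := ⟪K G, G⟫ - q 0 with hc
  have hcpos : 0 < c := sub_pos.2 hloss
  obtain ⟨κ, hκ, hsκ⟩ : ∃ κ : ℝ, 0 < κ ∧ ∀ t, 0 ≤ t → κ ≤ s t ^ 2 := by
    -- Expand `q t ≤ q 0`, drop the nonnegative quadratic term, and bound the cross term by `2 ‖K G‖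
    -- s²` using `‖A‖ = |s|`.
    have key : ∀ t, 0 ≤ t → c ≤ 2 * ‖K G‖ * s t ^ 2 := by
      intro t ht
      have h1 : q t = s t ^ 2 * ⟪K (A t), A t⟫ - 2 * (s t * ⟪K G, A t⟫) + ⟪K G, G⟫ := by
        simp only [hq, hZ, map_sub, map_smul, inner_sub_left, inner_sub_right,
          real_inner_smul_left, real_inner_smul_right]
        rw [hK (A t) G, real_inner_comm (K G) (A t)]
        ring
      have h2 : 0 ≤ ⟪K (A t), A t⟫ := by
        have := hpos (A t)
        by_contra hneg
        push Not at hneg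
        nlinarith [sq_nonneg ‖A t‖, mul_pos_of_neg_of_neg hneg (neg_neg_of_pos hk)]
      have h3 := hqanti t ht
      have h4 : s t * ⟪K G, A t⟫ ≤ ‖K G‖ * s t ^ 2 := by
        have hn : ‖A t‖ = |s t| := by
          rw [← abs_of_nonneg (norm_nonneg (A t))]
          exact sq_eq_sq_iff_abs_eq_abs _ _ |>.1 (hbalance t ht)
        calc s t * ⟪K G, A t⟫ ≤ |s t * ⟪K G, A t⟫| := le_abs_self _
          _ = |s t| * |⟪K G, A t⟫| := abs_mul _ _
          _ ≤ |s t| * (‖K G‖ * ‖A t‖) := by gcongr; exact abs_real_inner_le_norm _ _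
          _ = ‖K G‖ * s t ^ 2 := by rw [hn, ← sq_abs (s t)]; ring
      have h5 : 0 ≤ s t ^ 2 * ⟪K (A t), A t⟫ := by positivity
      linarith
    have hKG : 0 < ‖K G‖ := by
      have := key 0 le_rfl
      by_contra h
      have h0 : ‖K G‖ = 0 := le_antisymm (not_lt.1 h) (norm_nonneg _)
      rw [h0] at this
      linarith
    refine ⟨c / (2 * ‖K G‖), by positivity, fun t ht => ?_⟩
    rw [div_le_iff₀ (by positivity)]
    linarith [key t ht]
  have hscont : ContinuousOn s (Set.Ici 0) := fun t ht => (hs t ht).continuousWithinAt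
  have hspos : ∀ t, 0 ≤ t → 0 < s t := by
    intro t ht
    by_contra hneg
    push Not at hneg
    -- A change of sign would make `s` vanish somewhere, against `κ ≤ s²`.
    obtain ⟨u, hu, hu0⟩ := intermediate_value_Icc' ht
      (hscont.mono Set.Icc_subset_Ici_self) ⟨hneg, hs0.le⟩
    have := hsκ u hu.1
    rw [hu0] at this
    simp at this
    linarith
  -- Grönwall: `q' ≤ -2 s² ‖K Z‖² ≤ -(2κ/k) q`, so `q · exp (2κt/k)` is antitone.
  have hdecay : ∀ t, 0 ≤ t → q t ≤ q 0 * Real.exp (-(2 * κ / k * t)) := by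
    intro t ht
    have hexp : ∀ t : ℝ, HasDerivWithinAt (fun t : ℝ => Real.exp (2 * κ / k * t))
        (Real.exp (2 * κ / k * t) * (2 * κ / k)) (Set.Ici 0) t := fun t => by
      simpa using (((hasDerivAt_id' t).const_mul (2 * κ / k)).exp).hasDerivWithinAt
    have h := antitoneOn_Ici_of_hasDerivWithinAt (fun t ht => (hqd t ht).fun_mul (hexp t))
      (fun t ht => by
        have h1 : κ * q t ≤ k * (s t ^ 2 * ‖K (Z t)‖ ^ 2) := by
          calc κ * q t ≤ s t ^ 2 * (k * ‖K (Z t)‖ ^ 2) :=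
                mul_le_mul (hsκ t ht) (hqle t) (hqnn t) (sq_nonneg _)
            _ = _ := by ring
        have h2 : κ * q t / k ≤ s t ^ 2 * ‖K (Z t)‖ ^ 2 := by
          rw [div_le_iff₀ hk]; linarith
        have h3 : -(2 * (⟪K (Z t), A t⟫ ^ 2 + s t ^ 2 * ‖K (Z t)‖ ^ 2)) + 2 * (κ * q t / k) ≤ 0 := by
          nlinarith [sq_nonneg ⟪K (Z t), A t⟫]
        have h4 := mul_nonpos_of_nonneg_of_nonpos (Real.exp_pos (2 * κ / k * t)).le h3
        calc _ = Real.exp (2 * κ / k * t) *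
            (-(2 * (⟪K (Z t), A t⟫ ^ 2 + s t ^ 2 * ‖K (Z t)‖ ^ 2)) + 2 * (κ * q t / k)) := by ring
          _ ≤ 0 := h4) Set.self_mem_Ici ht ht
    simp only [mul_zero, Real.exp_zero, mul_one] at h
    rw [Real.exp_neg, ← div_eq_mul_inv, le_div_iff₀ (Real.exp_pos _)]
    exact h
  have hqlim : Tendsto q atTop (𝓝 0) := by
    have h1 : Tendsto (fun t : ℝ => q 0 * Real.exp (-(2 * κ / k * t))) atTop (𝓝 (q 0 * 0)) := by
      refine Tendsto.const_mul _ (Real.tendsto_exp_neg_atTop_nhds_zero.comp ?_)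
      exact tendsto_id.const_mul_atTop (by positivity)
    rw [mul_zero] at h1
    refine squeeze_zero' (Eventually.of_forall hqnn) ?_ h1
    filter_upwards [eventually_ge_atTop 0] with t ht using hdecay t ht
  have hZlim : Tendsto Z atTop (𝓝 0) := by
    rw [tendsto_zero_iff_norm_tendsto_zero]
    have h1 : Tendsto (fun t => √(k * q t)) atTop (𝓝 0) := by
      have := (hqlim.const_mul k).sqrt
      simpa using this
    exact squeeze_zero (fun t => norm_nonneg _) (fun t => Real.le_sqrt_of_sq_le (hpos (Z t))) h1
  have hsA : Tendsto (fun t => s t • A t) atTop (𝓝 G) := by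
    have := hZlim.add_const G
    simpa [hZ] using this
  -- Balance recovers `s` from the product alone, which lets the two factors converge separately.
  have hsnorm : (fun t => s t ^ 2) =ᶠ[atTop] fun t => ‖s t • A t‖ := by
    filter_upwards [eventually_ge_atTop 0] with t ht
    have hn : ‖A t‖ = s t := by
      have h := hbalance t ht
      exact (sq_eq_sq₀ (norm_nonneg _) (hspos t ht).le).1 h
    rw [norm_smul, hn, Real.norm_of_nonneg (hspos t ht).le, sq]
  have hs2 : Tendsto (fun t => s t ^ 2) atTop (𝓝 ‖G‖) := hsA.norm.congr' hsnorm.symm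
  have hGpos : 0 < ‖G‖ := hκ.trans_le <| ge_of_tendsto hs2 <| by
    filter_upwards [eventually_ge_atTop 0] with t ht using hsκ t ht
  have hslim : Tendsto s atTop (𝓝 √‖G‖) := by
    refine hs2.sqrt.congr' ?_
    filter_upwards [eventually_ge_atTop 0] with t ht using Real.sqrt_sq (hspos t ht).le
  have hsG : √‖G‖ ≠ 0 := (Real.sqrt_pos.2 hGpos).ne'
  refine ⟨(√‖G‖)⁻¹ • G, √‖G‖, ?_, hslim, smul_inv_smul₀ hsG G⟩
  refine ((hslim.inv₀ hsG).smul hsA).congr' ?_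
  filter_upwards [eventually_ge_atTop 0] with t ht
  exact inv_smul_smul₀ (hspos t ht).ne' _

end AbstractFlow
-- Moments of the empirical covariance
section EmpiricalCovariance

variable {d T : ℕ} {Λ : Matrix (Fin d) (Fin d) ℝ}

/-- The law of the covariates of a prompt. -/
noncomputable abbrev covariateLaw (Λ : Matrix (Fin d) (Fin d) ℝ) (T : ℕ) :
    Measure (Fin T → EuclideanSpace ℝ (Fin d)) :=
  Measure.pi fun _ : Fin T => multivariateGaussian 0 Λ

/-- The empirical second moment matrix of the covariates of a prompt. -/
noncomputable def empCov (x : Fin T → EuclideanSpace ℝ (Fin d)) : Matrix (Fin d) (Fin d) ℝ :=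
  Matrix.of fun a b => (T : ℝ)⁻¹ * ∑ i, x i a * x i b

theorem empCov_apply (x : Fin T → EuclideanSpace ℝ (Fin d)) (a b : Fin d) :
    empCov x a b = (T : ℝ)⁻¹ * ∑ i, x i a * x i b := rfl

theorem empCov_transpose (x : Fin T → EuclideanSpace ℝ (Fin d)) : (empCov x)ᵀ = empCov x := by
  ext a b
  simp only [transpose_apply, empCov_apply]
  simp_rw [mul_comm (x _ b)]

theorem allMoments_covariate (i : Fin T) (a : Fin d) :
    AllMoments (fun x : Fin T → EuclideanSpace ℝ (Fin d) => x i a) (covariateLaw Λ T) :=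
  (allMoments_coord (multivariateGaussian 0 Λ) a).comp_measurePreserving
    (measurePreserving_eval _ i)

theorem allMoments_empCov (a b : Fin d) :
    AllMoments (fun x : Fin T → EuclideanSpace ℝ (Fin d) => empCov x a b) (covariateLaw Λ T) :=
  (AllMoments.sum _ fun i _ => (allMoments_covariate i a).mul (allMoments_covariate i b)).const_mul _

theorem integral_covariate_mul_covariate (hΛ : Λ.PosSemidef) (i : Fin T) (a b : Fin d) :
    ∫ x : Fin T → EuclideanSpace ℝ (Fin d), x i a * x i b ∂(covariateLaw Λ T) = Λ a b := by
  rw [← integral_coord_mul_coord_multivariateGaussian hΛ a b]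
  exact integral_comp_eval (μ := fun _ : Fin T => multivariateGaussian 0 Λ) (i := i)
    (f := fun y : EuclideanSpace ℝ (Fin d) => y a * y b) (by fun_prop)

theorem integral_empCov (hT : 0 < T) (hΛ : Λ.PosSemidef) (a b : Fin d) :
    ∫ x : Fin T → EuclideanSpace ℝ (Fin d), empCov x a b ∂(covariateLaw Λ T) = Λ a b := by
  have hT' : (T : ℝ) ≠ 0 := by positivity
  simp_rw [empCov_apply]
  rw [integral_const_mul, AllMoments.integral_sum _ fun i _ =>
    (allMoments_covariate i a).mul (allMoments_covariate i b)]
  simp [integral_covariate_mul_covariate hΛ, hT']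

/-- Distinct examples are independent, which leaves a product of covariances; for `i = j` Isserlis
adds two further pairings. -/
theorem integral_covariate_quadruple (hΛ : Λ.PosSemidef) (i j : Fin T) (a b c : Fin d) :
    ∫ x : Fin T → EuclideanSpace ℝ (Fin d), x i b * x i a * (x j a * x j c) ∂(covariateLaw Λ T) =
      Λ b a * Λ a c + if i = j then Λ b a * Λ a c + Λ a a * Λ b c else 0 := by
  have hsymm : ∀ i j, Λ i j = Λ j i := fun i j => by
    have := hΛ.1.apply i j; simpa using this.symm
  split_ifs with hij
  · subst hij
    have h := integral_four_coords_multivariateGaussian hΛ b a a c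
    have h2 := integral_comp_eval (μ := fun _ : Fin T => multivariateGaussian 0 Λ) (i := i)
      (f := fun y : EuclideanSpace ℝ (Fin d) => y b * y a * y a * y c) (by fun_prop)
    simp_rw [← mul_assoc]
    rw [h2, h]
    ring
  · have hind := (iIndepFun_pi (μ := fun _ : Fin T => multivariateGaussian 0 Λ)
      (X := fun _ => id) (fun _ => aemeasurable_id)).indepFun hij
    have hind' := hind.comp (φ := fun y : EuclideanSpace ℝ (Fin d) => y b * y a)
      (ψ := fun y : EuclideanSpace ℝ (Fin d) => y a * y c) (by fun_prop) (by fun_prop)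
    have h := hind'.integral_fun_mul_eq_mul_integral
      ((allMoments_covariate i b).mul (allMoments_covariate i a)).integrable.aestronglyMeasurable
      ((allMoments_covariate j a).mul (allMoments_covariate j c)).integrable.aestronglyMeasurable
    rw [add_zero, ← integral_covariate_mul_covariate hΛ i b a,
      ← integral_covariate_mul_covariate hΛ j a c]
    exact h

/-- This is where `Γ` comes from: among the `T²` pairs of examples the `T` diagonal ones contribute
the correction `(1/T)(Λ² + tr(Λ) Λ)`. -/
theorem integral_empCov_mul_empCov (hT : 0 < T) (hΛ : Λ.PosSemidef) (b c : Fin d) :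
    ∫ x : Fin T → EuclideanSpace ℝ (Fin d), (empCov x * empCov x) b c ∂(covariateLaw Λ T) =
      (Λ * Gam Λ T) b c := by
  have hT' : (T : ℝ) ≠ 0 := by positivity
  simp_rw [mul_apply]
  rw [AllMoments.integral_sum _ fun a _ => (allMoments_empCov b a).mul (allMoments_empCov a c)]
  have h1 (a : Fin d) : ∫ x : Fin T → EuclideanSpace ℝ (Fin d), empCov x b a * empCov x a c
      ∂(covariateLaw Λ T) =
      Λ b a * Λ a c + (T : ℝ)⁻¹ * (Λ b a * Λ a c + Λ a a * Λ b c) := by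
    have h2 (x : Fin T → EuclideanSpace ℝ (Fin d)) : empCov x b a * empCov x a c =
        (T : ℝ)⁻¹ * (T : ℝ)⁻¹ * ∑ i, ∑ j, x i b * x i a * (x j a * x j c) := by
      rw [empCov_apply, empCov_apply, ← Finset.sum_mul_sum]; ring
    simp_rw [h2]
    rw [integral_const_mul, AllMoments.integral_sum _ fun i _ => AllMoments.sum _ fun j _ =>
      ((allMoments_covariate i b).mul (allMoments_covariate i a)).mul
        ((allMoments_covariate j a).mul (allMoments_covariate j c))]
    have h3 (i : Fin T) := AllMoments.integral_sum (μ := covariateLaw Λ T) Finset.univ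
      fun (j : Fin T) _ => ((allMoments_covariate i b).mul (allMoments_covariate i a)).mul
        ((allMoments_covariate j a).mul (allMoments_covariate j c))
    simp_rw [h3, integral_covariate_quadruple hΛ]
    simp only [Finset.sum_add_distrib, Finset.sum_const, Finset.card_univ, Fintype.card_fin,
      Finset.sum_ite_eq, Finset.mem_univ, if_true, nsmul_eq_mul]
    field_simp
  simp_rw [h1]
  rw [Finset.sum_add_distrib, ← Finset.mul_sum, Finset.sum_add_distrib, ← Finset.sum_mul]
  have hG : (Λ * Gam Λ T) b c =
      (1 + 1 / (T : ℝ)) * (Λ * Λ) b c + (1 / (T : ℝ) * Λ.trace) * Λ b c := by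
    rw [Gam, Matrix.mul_add, Matrix.mul_smul, Matrix.mul_smul, Matrix.mul_one]
    rfl
  rw [mul_apply, mul_apply] at hG
  rw [hG]
  simp only [trace, diag]
  ring

theorem integral_trace_mul {X : Type*} {mX : MeasurableSpace X} {μ : Measure X}
    {F : X → Matrix (Fin d) (Fin d) ℝ} (hF : ∀ a b, AllMoments (fun x => F x a b) μ)
    {C : Matrix (Fin d) (Fin d) ℝ} (hC : ∀ a b, ∫ x, F x a b ∂μ = C a b)
    (B : Matrix (Fin d) (Fin d) ℝ) :
    ∫ x, (F x * B).trace ∂μ = (C * B).trace := by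
  simp only [trace, diag, mul_apply]
  have h0 (i j : Fin d) : AllMoments (fun x => F x i j * B j i) μ := by
    simpa only [mul_comm] using (hF i j).const_mul (B j i)
  rw [AllMoments.integral_sum _ fun i _ => AllMoments.sum _ fun j _ => h0 i j]
  refine Finset.sum_congr rfl fun i _ => ?_
  rw [AllMoments.integral_sum _ fun j _ => h0 i j]
  refine Finset.sum_congr rfl fun j _ => ?_
  rw [integral_mul_const, hC]

theorem allMoments_trace_mul {X : Type*} {mX : MeasurableSpace X} {μ : Measure X}
    {F : X → Matrix (Fin d) (Fin d) ℝ} (hF : ∀ a b, AllMoments (fun x => F x a b) μ)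
    (B : Matrix (Fin d) (Fin d) ℝ) : AllMoments (fun x => (F x * B).trace) μ := by
  simp only [trace, diag, mul_apply]
  exact AllMoments.sum _ fun i _ => AllMoments.sum _ fun j _ => by
    simpa only [mul_comm] using (hF i j).const_mul (B j i)

/-- Expected squared error of the linear predictor with matrix `s • empCov x * A` against the
identity, averaged over the covariates. -/
theorem integral_trace_residual (hT : 0 < T) (hΛ : Λ.PosSemidef) (s : ℝ)
    (A : Matrix (Fin d) (Fin d) ℝ) :
    ∫ x : Fin T → EuclideanSpace ℝ (Fin d),
      ((s • (empCov x * A) - 1) * Λ * (s • (empCov x * A) - 1)ᵀ).trace ∂(covariateLaw Λ T) =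
      s ^ 2 * (Λ * Gam Λ T * (A * Λ * Aᵀ)).trace - 2 * s * (Λ * (A * Λ)).trace + Λ.trace := by
  have hΛt : Λᵀ = Λ := by simpa using hΛ.1.eq
  -- Cyclicity and transposition invariance of the trace leave only `empCov x` and its square, whose
  -- expectations are known.
  have h (x : Fin T → EuclideanSpace ℝ (Fin d)) :
      ((s • (empCov x * A) - 1) * Λ * (s • (empCov x * A) - 1)ᵀ).trace =
        s ^ 2 * (empCov x * empCov x * (A * Λ * Aᵀ)).trace
          - (2 * s * (empCov x * (A * Λ)).trace - Λ.trace) := by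
    have e1 : (Λ * (Aᵀ * empCov x)).trace = (empCov x * (A * Λ)).trace := by
      rw [← trace_transpose]
      simp only [transpose_mul, transpose_transpose, hΛt, empCov_transpose, Matrix.mul_assoc]
    have e2 : (empCov x * A * Λ * (Aᵀ * empCov x)).trace =
        (empCov x * empCov x * (A * Λ * Aᵀ)).trace := by
      rw [← Matrix.mul_assoc _ Aᵀ, trace_mul_comm]
      simp only [Matrix.mul_assoc]
    simp only [transpose_sub, transpose_smul, transpose_mul, transpose_one, empCov_transpose,
      Matrix.sub_mul, Matrix.mul_sub, Matrix.smul_mul, Matrix.mul_smul, Matrix.one_mul,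
      Matrix.mul_one, trace_sub, trace_smul, smul_eq_mul, e1, Matrix.mul_assoc]
    simp only [← Matrix.mul_assoc] at e2 ⊢
    rw [e2]
    ring
  have hsq : ∀ a b, AllMoments (fun x : Fin T → EuclideanSpace ℝ (Fin d) =>
      (empCov x * empCov x) a b) (covariateLaw Λ T) := fun a b => by
    simp only [mul_apply]
    exact AllMoments.sum _ fun c _ => (allMoments_empCov a c).mul (allMoments_empCov c b)
  simp_rw [h]
  rw [AllMoments.integral_sub ((allMoments_trace_mul hsq _).const_mul _)
      (((allMoments_trace_mul allMoments_empCov _).const_mul _).sub (AllMoments.const _)),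
    AllMoments.integral_sub ((allMoments_trace_mul allMoments_empCov _).const_mul _)
      (AllMoments.const _), integral_const_mul, integral_const_mul,
    integral_trace_mul hsq (integral_empCov_mul_empCov hT hΛ),
    integral_trace_mul allMoments_empCov (integral_empCov hT hΛ)]
  simp
  ring

end EmpiricalCovariance
-- The in-context prediction as a polynomial
section Prediction

variable {d : ℕ} {ι : Type*} [Fintype ι]

/-- Reassociating to `(E Eᵀ)(W^{KQ} E)` separates parameters from data. The zero label of the query
kills the skip connection and the label column of `W^{KQ}`. -/
theorem icl_eq_sum (θ : Params d) (ex : ι → (Fin d → ℝ) × ℝ) (xq : Fin d → ℝ) :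
    icl θ ex xq = ∑ a, ∑ b, ∑ c, (Fintype.card ι : ℝ)⁻¹ * (θ.PV (Sum.inr ()) a *
      θ.KQ b (Sum.inl c)) * ((embedding ex xq * (embedding ex xq)ᵀ) a b * xq c) := by
  set E := embedding ex xq with hE
  have hassoc : θ.PV * E * (Eᵀ * θ.KQ * E) = θ.PV * (E * Eᵀ) * (θ.KQ * E) := by
    simp only [Matrix.mul_assoc]
  have hE0 : E (Sum.inr ()) (Sum.inr ()) = 0 := rfl
  have hEq : ∀ c, E (Sum.inl c) (Sum.inr ()) = xq c := fun _ => rfl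
  unfold icl lsa
  rw [← hE, hassoc, Matrix.add_apply, hE0, zero_add, Matrix.smul_apply, mul_apply, smul_eq_mul,
    Finset.sum_comm, Finset.mul_sum]
  refine Finset.sum_congr rfl fun b _ => ?_
  rw [mul_apply (M := θ.PV), mul_apply (M := θ.KQ), Fintype.sum_sum_type (fun c => θ.KQ b c * _)]
  simp only [Finset.univ_unique, Finset.sum_singleton, hEq, PUnit.default_eq_unit, hE0, mul_zero,
    add_zero]
  rw [Finset.sum_mul_sum, Finset.mul_sum]
  refine Finset.sum_congr rfl fun a _ => ?_
  rw [Finset.mul_sum]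
  exact Finset.sum_congr rfl fun c _ => by ring

/-- The query column enters the Gram matrix too, but drops out here because its label is `0`. -/
theorem gram_label_covariate (ex : ι → (Fin d → ℝ) × ℝ) (xq : Fin d → ℝ) (b : Fin d) :
    (embedding ex xq * (embedding ex xq)ᵀ) (Sum.inr ()) (Sum.inl b) =
      ∑ i, (ex i).2 * (ex i).1 b := by
  simp [embedding, mul_apply]

/-- For block diagonal parameters the prediction is bilinear in the label-weighted sum of the
covariates and the query. -/
theorem icl_of_block {θ : Params d} (hPV : ∀ a, θ.PV (Sum.inr ()) (Sum.inl a) = 0)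
    (hKQ : ∀ c, θ.KQ (Sum.inr ()) (Sum.inl c) = 0) (ex : ι → (Fin d → ℝ) × ℝ) (xq : Fin d → ℝ) :
    icl θ ex xq = (Fintype.card ι : ℝ)⁻¹ * ((∑ i, (ex i).2 • (ex i).1) ⬝ᵥ
      ((θ.PV (Sum.inr ()) (Sum.inr ()) • θ.KQ.toBlocks₁₁) *ᵥ xq)) := by
  rw [icl_eq_sum, Fintype.sum_sum_type]
  simp only [hPV, zero_mul, mul_zero, Finset.sum_const_zero, zero_add, Finset.univ_unique,
    Finset.sum_singleton, PUnit.default_eq_unit, Fintype.sum_sum_type, hKQ, add_zero,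
    gram_label_covariate]
  simp only [dotProduct, mulVec, Finset.sum_apply, Pi.smul_apply, smul_eq_mul, Finset.mul_sum,
    Matrix.smul_apply, toBlocks₁₁, Matrix.of_apply]
  exact Finset.sum_congr rfl fun b _ => Finset.sum_congr rfl fun c _ => by ring

end Prediction

/-! ### Reflection symmetry of the loss -/

section SignFlip

variable {d : ℕ}

/-- The sign `-1` of the label coordinate and `1` of the covariate coordinates. -/
def tokSign : Tok d → ℝ := Sum.elim (fun _ => 1) (fun _ => -1)

/-- Whether an entry of a parameter lies in an off-diagonal block. -/
def isOffDiag : (Tok d × Tok d) ⊕ (Tok d × Tok d) → Bool :=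
  Sum.elim (fun p => xor p.1.isLeft p.2.isLeft) (fun p => xor p.1.isLeft p.2.isLeft)

/-- The reflection of the parameter space that changes the sign of the off-diagonal blocks. -/
noncomputable def signFlip (d : ℕ) : Params d ≃ₗᵢ[ℝ] Params d :=
  LinearIsometryEquiv.piLpCongrRight 2 fun p =>
    if isOffDiag p then LinearIsometryEquiv.neg ℝ else LinearIsometryEquiv.refl ℝ ℝ

theorem signFlip_apply (θ : Params d) (p) :
    signFlip d θ p = if isOffDiag p then - θ p else θ p := by
  simp only [signFlip, LinearIsometryEquiv.piLpCongrRight_apply]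
  split_ifs <;> simp

theorem signFlip_KQ (θ : Params d) (a b : Tok d) :
    (signFlip d θ).KQ a b = tokSign a * tokSign b * θ.KQ a b := by
  simp only [Params.KQ, Matrix.of_apply, signFlip_apply]
  rcases a with a | a <;> rcases b with b | b <;> simp [tokSign, isOffDiag]

theorem signFlip_PV (θ : Params d) (a b : Tok d) :
    (signFlip d θ).PV a b = tokSign a * tokSign b * θ.PV a b := by
  simp only [Params.PV, Matrix.of_apply, signFlip_apply]
  rcases a with a | a <;> rcases b with b | b <;> simp [tokSign, isOffDiag]

theorem embedding_neg_label {ι : Type*} (ex : ι → (Fin d → ℝ) × ℝ) (xq : Fin d → ℝ)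
    (a : Tok d) (k : ι ⊕ Unit) :
    embedding (fun i => ((ex i).1, -(ex i).2)) xq a k = tokSign a * embedding ex xq a k := by
  rcases a with a | a <;> rcases k with k | k <;> simp [embedding, tokSign]

/-- Negating labels conjugates the Gram matrix by `tokSign`. The signs at `a` and `b` match those of
the parameters, and the label row of `W^{PV}` leaves a single `-1`. -/
theorem icl_signFlip {ι : Type*} [Fintype ι] (θ : Params d) (ex : ι → (Fin d → ℝ) × ℝ)
    (xq : Fin d → ℝ) :
    icl (signFlip d θ) ex xq = - icl θ (fun i => ((ex i).1, -(ex i).2)) xq := by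
  have hG (a b : Tok d) : (embedding (fun i => ((ex i).1, -(ex i).2)) xq *
      (embedding (fun i => ((ex i).1, -(ex i).2)) xq)ᵀ) a b =
      tokSign a * tokSign b * (embedding ex xq * (embedding ex xq)ᵀ) a b := by
    rw [mul_apply, mul_apply, Finset.mul_sum]
    refine Finset.sum_congr rfl fun k _ => ?_
    simp only [transpose_apply, embedding_neg_label]
    ring
  rw [icl_eq_sum, icl_eq_sum]
  simp only [← Finset.sum_neg_distrib, hG, signFlip_KQ, signFlip_PV]
  refine Finset.sum_congr rfl fun a _ => Finset.sum_congr rfl fun b _ =>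
    Finset.sum_congr rfl fun c _ => ?_
  have h1 : tokSign (Sum.inr () : Tok d) = -1 := rfl
  have h2 : tokSign (Sum.inl c : Tok d) = 1 := rfl
  rw [h1, h2]
  ring

theorem measurePreserving_neg_stdGaussian :
    MeasurePreserving (Neg.neg : EuclideanSpace ℝ (Fin d) → EuclideanSpace ℝ (Fin d))
      (multivariateGaussian 0 1) (multivariateGaussian 0 1) := by
  refine ⟨measurable_neg, ?_⟩
  rw [multivariateGaussian_zero_one]
  exact stdGaussian_map (LinearIsometryEquiv.neg ℝ (E := EuclideanSpace ℝ (Fin d)))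

/-- The change of variables `w ↦ -w` negates the labels and the target together, so the residual
only changes sign. -/
theorem populationLoss_signFlip (Λ : Matrix (Fin d) (Fin d) ℝ) (T : ℕ) (θ : Params d) :
    populationLoss Λ T (signFlip d θ) = populationLoss Λ T θ := by
  have hmp : MeasurePreserving (MeasurableEquiv.prodCongr
      (MeasurableEquiv.neg (EuclideanSpace ℝ (Fin d)))
      (MeasurableEquiv.refl ((Fin T → EuclideanSpace ℝ (Fin d)) × EuclideanSpace ℝ (Fin d))))
      (taskLaw Λ T) (taskLaw Λ T) :=
    measurePreserving_neg_stdGaussian.prod (MeasurePreserving.id _)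
  unfold populationLoss
  rw [← hmp.integral_comp']
  congr 2
  funext p
  have h : (MeasurableEquiv.prodCongr (MeasurableEquiv.neg (EuclideanSpace ℝ (Fin d)))
      (MeasurableEquiv.refl ((Fin T → EuclideanSpace ℝ (Fin d)) × EuclideanSpace ℝ (Fin d)))) p =
      (-p.1, p.2) := rfl
  rw [h, icl_signFlip]
  simp only [inner_neg_left]
  ring_nf

end SignFlip

/-! ### Smoothness and closed form of the loss -/

section Loss

variable {d T : ℕ} {Λ : Matrix (Fin d) (Fin d) ℝ}

theorem allMoments_task_weight (a : Fin d) :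
    AllMoments (fun p : EuclideanSpace ℝ (Fin d) ×
      ((Fin T → EuclideanSpace ℝ (Fin d)) × EuclideanSpace ℝ (Fin d)) => p.1 a) (taskLaw Λ T) :=
  (allMoments_coord (multivariateGaussian 0 1) a).comp_measurePreserving measurePreserving_fst

theorem allMoments_task_covariates {f : (Fin T → EuclideanSpace ℝ (Fin d)) → ℝ}
    (hf : AllMoments f (covariateLaw Λ T)) :
    AllMoments (fun p : EuclideanSpace ℝ (Fin d) ×
      ((Fin T → EuclideanSpace ℝ (Fin d)) × EuclideanSpace ℝ (Fin d)) => f p.2.1) (taskLaw Λ T) :=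
  hf.comp_measurePreserving (measurePreserving_fst.comp measurePreserving_snd)

theorem allMoments_task_query (a : Fin d) :
    AllMoments (fun p : EuclideanSpace ℝ (Fin d) ×
      ((Fin T → EuclideanSpace ℝ (Fin d)) × EuclideanSpace ℝ (Fin d)) => p.2.2 a) (taskLaw Λ T) :=
  (allMoments_coord (multivariateGaussian 0 Λ) a).comp_measurePreserving
    (measurePreserving_snd.comp measurePreserving_snd)

theorem inner_eq_sum_mul (w x : EuclideanSpace ℝ (Fin d)) : inner ℝ w x = ∑ a, w a * x a := by
  simp [PiLp.inner_apply, mul_comm]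

instance : IsProbabilityMeasure (taskLaw Λ T) := by
  unfold taskLaw; infer_instance

/-- Expanding the square pulls the parameter out of the integral, so nothing is differentiated under
the integral sign. -/
theorem contDiff_integral_sq_of_sum {X J : Type*} [Fintype J] {mX : MeasurableSpace X}
    {μ : Measure X} {F : Type*} [NormedAddCommGroup F] [NormedSpace ℝ F] {c : J → F → ℝ}
    {f : J → X → ℝ} {n : WithTop ℕ∞} (hc : ∀ j, ContDiff ℝ n (c j))
    (hf : ∀ j, AllMoments (f j) μ) :
    ContDiff ℝ n fun θ => ∫ x, (∑ j, c j θ * f j x) ^ 2 ∂μ := by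
  have h : (fun θ => ∫ x, (∑ j, c j θ * f j x) ^ 2 ∂μ) =
      fun θ => ∑ i, ∑ j, c i θ * c j θ * ∫ x, f i x * f j x ∂μ := by
    funext θ
    have h1 (x : X) : (∑ j, c j θ * f j x) ^ 2 = ∑ i, ∑ j, c i θ * c j θ * (f i x * f j x) := by
      rw [sq, Finset.sum_mul_sum]
      exact Finset.sum_congr rfl fun i _ => Finset.sum_congr rfl fun j _ => by ring
    simp_rw [h1]
    rw [AllMoments.integral_sum _ fun i _ => AllMoments.sum _ fun j _ =>
      ((hf i).mul (hf j)).const_mul _]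
    refine Finset.sum_congr rfl fun i _ => ?_
    rw [AllMoments.integral_sum _ fun j _ => ((hf i).mul (hf j)).const_mul _]
    exact Finset.sum_congr rfl fun j _ => integral_const_mul _ _
  rw [h]
  exact ContDiff.sum fun i _ => ContDiff.sum fun j _ => ((hc i).mul (hc j)).mul contDiff_const

theorem allMoments_embedding (a : Tok d) (k : Fin T ⊕ Unit) :
    AllMoments (fun p : EuclideanSpace ℝ (Fin d) ×
      ((Fin T → EuclideanSpace ℝ (Fin d)) × EuclideanSpace ℝ (Fin d)) =>
      embedding (fun i : Fin T => ((p.2.1 i).ofLp, inner ℝ p.1 (p.2.1 i))) p.2.2.ofLp a k)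
      (taskLaw Λ T) := by
  rcases a with a | a <;> rcases k with k | k
  · exact allMoments_task_covariates (allMoments_covariate k a)
  · exact allMoments_task_query a
  · simp only [embedding, fromBlocks_apply₂₁, Matrix.of_apply, inner_eq_sum_mul]
    exact AllMoments.sum _ fun b _ => (allMoments_task_weight b).mul
      (allMoments_task_covariates (allMoments_covariate k b))
  · exact AllMoments.const 0

theorem contDiff_populationLoss {n : WithTop ℕ∞} : ContDiff ℝ n (populationLoss Λ T) := by
  -- The residual as a finite sum: `none` is the target with coefficient `-1`, the other indices are
  -- the terms of `icl_eq_sum`.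
  let c : Option (Tok d × Tok d × Fin d) → Params d → ℝ := fun j θ => j.elim (-1) fun q =>
    (Fintype.card (Fin T) : ℝ)⁻¹ * (θ (Sum.inr (Sum.inr (), q.1)) *
      θ (Sum.inl (q.2.1, Sum.inl q.2.2)))
  let f : Option (Tok d × Tok d × Fin d) → EuclideanSpace ℝ (Fin d) ×
      ((Fin T → EuclideanSpace ℝ (Fin d)) × EuclideanSpace ℝ (Fin d)) → ℝ := fun j p =>
    j.elim (inner ℝ p.1 p.2.2) fun q =>
      (embedding (fun i : Fin T => ((p.2.1 i).ofLp, inner ℝ p.1 (p.2.1 i))) p.2.2.ofLp *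
      (embedding (fun i : Fin T => ((p.2.1 i).ofLp, inner ℝ p.1 (p.2.1 i))) p.2.2.ofLp)ᵀ) q.1 q.2.1
        * p.2.2 q.2.2
  have hc : ∀ j, ContDiff ℝ n (c j) := by
    rintro (_ | q)
    · exact contDiff_const
    · simp only [c, Option.elim]
      fun_prop
  have hf : ∀ j, AllMoments (f j) (taskLaw Λ T) := by
    rintro (_ | q)
    · simp only [f, Option.elim, inner_eq_sum_mul]
      exact AllMoments.sum _ fun b _ => (allMoments_task_weight b).mul (allMoments_task_query b)
    · simp only [f, Option.elim, mul_apply, transpose_apply]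
      exact (AllMoments.sum _ fun k _ =>
        (allMoments_embedding q.1 k).mul (allMoments_embedding q.2.1 k)).mul
          (allMoments_task_query q.2.2)
  have h : populationLoss Λ T = fun θ => (1 / 2) * ∫ p, (∑ j, c j θ * f j p) ^ 2 ∂(taskLaw Λ T) := by
    funext θ
    unfold populationLoss
    congr 2
    funext p
    congr 1
    rw [icl_eq_sum, Fintype.sum_option, Fintype.sum_prod_type]
    simp only [Fintype.sum_prod_type, c, f, Option.elim]
    rw [neg_one_mul, neg_add_eq_sub]
    rfl
  rw [h]
  exact contDiff_const.mul (contDiff_integral_sq_of_sum hc hf)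

/-- The population loss of block diagonal parameters. -/
theorem populationLoss_of_block (hT : 0 < T) (hΛ : Λ.PosSemidef) {θ : Params d}
    (hPV : ∀ a, θ.PV (Sum.inr ()) (Sum.inl a) = 0) (hKQ : ∀ c, θ.KQ (Sum.inr ()) (Sum.inl c) = 0) :
    populationLoss Λ T θ = (1 / 2) * ((θ.PV (Sum.inr ()) (Sum.inr ())) ^ 2 *
      (Λ * Gam Λ T * (θ.KQ.toBlocks₁₁ * Λ * θ.KQ.toBlocks₁₁ᵀ)).trace
      - 2 * θ.PV (Sum.inr ()) (Sum.inr ()) * (Λ * (θ.KQ.toBlocks₁₁ * Λ)).trace + Λ.trace) := by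
  set s := θ.PV (Sum.inr ()) (Sum.inr ()) with hs
  set A := θ.KQ.toBlocks₁₁ with hA
  let R : (Fin T → EuclideanSpace ℝ (Fin d)) → Matrix (Fin d) (Fin d) ℝ :=
    fun x => s • (empCov x * A) - 1
  have hR : ∀ a c, AllMoments (fun x => R x a c) (covariateLaw Λ T) := by
    intro a c
    have : (fun x => R x a c) = fun x => s * ∑ b, empCov x a b * A b c - (1 : Matrix _ _ ℝ) a c := by
      funext x
      simp only [R, Matrix.sub_apply, Matrix.smul_apply, mul_apply, smul_eq_mul]
    rw [this]
    refine ((AllMoments.sum _ fun b _ => ?_).const_mul s).sub (AllMoments.const _)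
    simpa only [mul_comm] using (allMoments_empCov a b).const_mul (A b c)
  have hres (p : EuclideanSpace ℝ (Fin d) ×
      ((Fin T → EuclideanSpace ℝ (Fin d)) × EuclideanSpace ℝ (Fin d))) :
      icl θ (fun i : Fin T => ((p.2.1 i).ofLp, inner ℝ p.1 (p.2.1 i))) p.2.2.ofLp
        - inner ℝ p.1 p.2.2 = ∑ a, ∑ c, p.1 a * (R p.2.1 a c * p.2.2 c) := by
    have h1 : (Fintype.card (Fin T) : ℝ)⁻¹ • ∑ i, (inner ℝ p.1 (p.2.1 i)) • (p.2.1 i).ofLp =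
        p.1.ofLp ᵥ* empCov p.2.1 := by
      funext b
      simp only [Pi.smul_apply, Finset.sum_apply, smul_eq_mul, inner_eq_sum_mul, vecMul, dotProduct,
        empCov_apply, Fintype.card_fin, Finset.mul_sum, Finset.sum_mul]
      rw [Finset.sum_comm]
      exact Finset.sum_congr rfl fun a _ => Finset.sum_congr rfl fun i _ => by ring
    have h2 : inner ℝ p.1 p.2.2 = p.1.ofLp ⬝ᵥ ((1 : Matrix (Fin d) (Fin d) ℝ) *ᵥ p.2.2.ofLp) := by
      rw [one_mulVec, inner_eq_sum_mul]; rfl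
    rw [icl_of_block hPV hKQ, ← smul_eq_mul, ← smul_dotProduct, h1, h2, ← dotProduct_mulVec,
      mulVec_mulVec, Matrix.mul_smul, ← dotProduct_sub, ← Matrix.sub_mulVec]
    simp only [dotProduct, mulVec, Finset.mul_sum]
    rfl
  have hsq (p : EuclideanSpace ℝ (Fin d) ×
      ((Fin T → EuclideanSpace ℝ (Fin d)) × EuclideanSpace ℝ (Fin d))) :
      (∑ a, ∑ c, p.1 a * (R p.2.1 a c * p.2.2 c)) ^ 2 = ∑ a, ∑ a', ∑ c, ∑ c',
        (p.1 a * p.1 a') * ((R p.2.1 a c * R p.2.1 a' c') * (p.2.2 c * p.2.2 c')) := by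
    rw [sq, Finset.sum_mul_sum]
    refine Finset.sum_congr rfl fun a _ => Finset.sum_congr rfl fun a' _ => ?_
    rw [Finset.sum_mul_sum]
    exact Finset.sum_congr rfl fun c _ => Finset.sum_congr rfl fun c' _ => by ring
  have hAM (a a' c c' : Fin d) : AllMoments (fun p : EuclideanSpace ℝ (Fin d) ×
      ((Fin T → EuclideanSpace ℝ (Fin d)) × EuclideanSpace ℝ (Fin d)) =>
      (p.1 a * p.1 a') * ((R p.2.1 a c * R p.2.1 a' c') * (p.2.2 c * p.2.2 c'))) (taskLaw Λ T) :=
    ((allMoments_task_weight a).mul (allMoments_task_weight a')).mul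
      ((allMoments_task_covariates ((hR a c).mul (hR a' c'))).mul
        ((allMoments_task_query c).mul (allMoments_task_query c')))
  -- Weight, covariates and query are independent, and the weight has identity covariance, so only
  -- `a = a'` will survive.
  have hint (a a' c c' : Fin d) : ∫ p : EuclideanSpace ℝ (Fin d) ×
      ((Fin T → EuclideanSpace ℝ (Fin d)) × EuclideanSpace ℝ (Fin d)),
      (p.1 a * p.1 a') * ((R p.2.1 a c * R p.2.1 a' c') * (p.2.2 c * p.2.2 c')) ∂(taskLaw Λ T) =
      (1 : Matrix (Fin d) (Fin d) ℝ) a a' *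
        ∫ x, R x a c * (Λ c c' * R x a' c') ∂(covariateLaw Λ T) := by
    have e1 := integral_prod_mul (μ := multivariateGaussian (0 : EuclideanSpace ℝ (Fin d)) 1)
      (ν := (covariateLaw Λ T).prod (multivariateGaussian 0 Λ))
      (fun w : EuclideanSpace ℝ (Fin d) => w a * w a')
      (fun q => (R q.1 a c * R q.1 a' c') * (q.2 c * q.2 c'))
    have e2 := integral_prod_mul (μ := covariateLaw Λ T)
      (ν := multivariateGaussian (0 : EuclideanSpace ℝ (Fin d)) Λ)
      (fun x => R x a c * R x a' c') (fun y : EuclideanSpace ℝ (Fin d) => y c * y c')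
    refine e1.trans ?_
    rw [e2, integral_coord_mul_coord_multivariateGaussian hΛ,
      integral_coord_mul_coord_multivariateGaussian PosSemidef.one, ← integral_mul_const]
    congr 2
    funext x
    ring
  have htr : ∫ x, (R x * Λ * (R x)ᵀ).trace ∂(covariateLaw Λ T) =
      ∑ a, ∑ c, ∑ c', ∫ x, R x a c * (Λ c c' * R x a c') ∂(covariateLaw Λ T) := by
    have e (x : Fin T → EuclideanSpace ℝ (Fin d)) : (R x * Λ * (R x)ᵀ).trace =
        ∑ a, ∑ c, ∑ c', R x a c * (Λ c c' * R x a c') := by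
      rw [Matrix.mul_assoc]
      simp only [trace, diag, mul_apply, transpose_apply, Finset.mul_sum]
    simp_rw [e]
    have hm (a c c' : Fin d) : AllMoments (fun x => R x a c * (Λ c c' * R x a c'))
        (covariateLaw Λ T) := (hR a c).mul ((hR a c').const_mul _)
    rw [AllMoments.integral_sum _ fun a _ => AllMoments.sum _ fun c _ => AllMoments.sum _
      fun c' _ => hm a c c']
    refine Finset.sum_congr rfl fun a _ => ?_
    rw [AllMoments.integral_sum _ fun c _ => AllMoments.sum _ fun c' _ => hm a c c']
    refine Finset.sum_congr rfl fun c _ => ?_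
    rw [AllMoments.integral_sum _ fun c' _ => hm a c c']
  rw [← integral_trace_residual hT hΛ, htr]
  unfold populationLoss
  simp_rw [hres, hsq]
  congr 1
  rw [AllMoments.integral_sum _ fun a _ => AllMoments.sum _ fun a' _ => AllMoments.sum _
    fun c _ => AllMoments.sum _ fun c' _ => hAM a a' c c']
  refine Finset.sum_congr rfl fun a _ => ?_
  rw [AllMoments.integral_sum _ fun a' _ => AllMoments.sum _
    fun c _ => AllMoments.sum _ fun c' _ => hAM a a' c c']
  rw [Finset.sum_eq_single a]
  · rw [AllMoments.integral_sum _ fun c _ => AllMoments.sum _ fun c' _ => hAM a a c c']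
    refine Finset.sum_congr rfl fun c _ => ?_
    rw [AllMoments.integral_sum _ fun c' _ => hAM a a c c']
    refine Finset.sum_congr rfl fun c' _ => ?_
    rw [hint, one_apply_eq, one_mul]
  · intro a' _ ha
    rw [AllMoments.integral_sum _ fun c _ => AllMoments.sum _ fun c' _ => hAM a a' c c']
    refine Finset.sum_eq_zero fun c _ => ?_
    rw [AllMoments.integral_sum _ fun c' _ => hAM a a' c c']
    refine Finset.sum_eq_zero fun c' _ => ?_
    rw [hint, one_apply_ne ha.symm, zero_mul]
  · simp

end Loss
-- Uniqueness and symmetry of gradient flows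
section GradientFlow

open scoped RealInnerProductSpace

variable {E : Type*} [NormedAddCommGroup E] [InnerProductSpace ℝ E]

/-- On `[0, t]` both curves stay in one closed ball, where the `C¹` field is Lipschitz. -/
theorem eq_of_hasDerivWithinAt_autonomous [FiniteDimensional ℝ E] {v : E → E}
    (hv : ContDiff ℝ 1 v) {f g : ℝ → E}
    (hf : ∀ t, 0 ≤ t → HasDerivWithinAt f (v (f t)) (Set.Ici 0) t)
    (hg : ∀ t, 0 ≤ t → HasDerivWithinAt g (v (g t)) (Set.Ici 0) t) (h0 : f 0 = g 0)
    {t : ℝ} (ht : 0 ≤ t) : f t = g t := by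
  have hfc : ContinuousOn f (Set.Icc 0 t) := fun u hu =>
    ((hf u hu.1).mono Set.Icc_subset_Ici_self).continuousWithinAt
  have hgc : ContinuousOn g (Set.Icc 0 t) := fun u hu =>
    ((hg u hu.1).mono Set.Icc_subset_Ici_self).continuousWithinAt
  obtain ⟨R, hR⟩ := ((isCompact_Icc.image_of_continuousOn hfc).isBounded.union
    (isCompact_Icc.image_of_continuousOn hgc).isBounded).subset_closedBall (0 : E)
  obtain ⟨C, hC⟩ := hv.contDiffOn.exists_lipschitzOnWith (s := Metric.closedBall (0 : E) R)
    one_ne_zero (convex_closedBall _ _) (isCompact_closedBall _ _)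
  refine ODE_solution_unique_of_mem_Icc_right (v := fun _ => v)
    (s := fun _ => Metric.closedBall (0 : E) R) (K := C) (a := 0) (b := t)
    (fun _ _ => hC) hfc (fun u hu => (hf u hu.1).mono (Set.Ici_subset_Ici.2 hu.1))
    (fun u hu => hR (Or.inl ⟨u, ⟨hu.1, hu.2.le⟩, rfl⟩)) hgc
    (fun u hu => (hg u hu.1).mono (Set.Ici_subset_Ici.2 hu.1))
    (fun u hu => hR (Or.inr ⟨u, ⟨hu.1, hu.2.le⟩, rfl⟩)) h0 ⟨ht, le_rfl⟩

variable [CompleteSpace E]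

theorem contDiff_gradient {F : E → ℝ} (hF : ContDiff ℝ 2 F) : ContDiff ℝ 1 (gradient F) := by
  have h : ContDiff ℝ 1 (fderiv ℝ F) := hF.fderiv_right (m := 1) (by norm_num)
  exact (InnerProductSpace.toDual ℝ E).symm.contDiff.comp h

/-- Differentiate `F ∘ S = F` and use that `S` preserves inner products. Consequently `S` maps
gradient flow lines to gradient flow lines. -/
theorem gradient_apply_of_invariant {F : E → ℝ} (hF : Differentiable ℝ F) {S : E ≃ₗᵢ[ℝ] E}
    (hS : ∀ x, F (S x) = F x) (x : E) : gradient F (S x) = S (gradient F x) := by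
  refine ext_inner_right ℝ fun y => ?_
  obtain ⟨z, rfl⟩ := S.surjective y
  rw [S.inner_map_map, inner_gradient_left, inner_gradient_left]
  have h1 : HasFDerivAt (fun x => F (S x)) ((fderiv ℝ F (S x)).comp
      (S.toContinuousLinearEquiv : E →L[ℝ] E)) x :=
    (hF (S x)).hasFDerivAt.comp x (S.toContinuousLinearEquiv : E →L[ℝ] E).hasFDerivAt
  have h2 : (fun x => F (S x)) = F := funext hS
  rw [h2] at h1
  rw [h1.fderiv]
  rfl

end GradientFlow

/-! ### Frobenius geometry and coercivity -/

section MatrixNorm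

open scoped RealInnerProductSpace

variable {d : ℕ}

/-- A matrix as a vector of its entries with the Euclidean (Frobenius) inner product. -/
noncomputable def matVec (A : Matrix (Fin d) (Fin d) ℝ) : EuclideanSpace ℝ (Fin d × Fin d) :=
  WithLp.toLp 2 fun p => A p.1 p.2

@[simp] theorem matVec_apply (A : Matrix (Fin d) (Fin d) ℝ) (p : Fin d × Fin d) :
    matVec A p = A p.1 p.2 := rfl

theorem matVec_smul (c : ℝ) (A : Matrix (Fin d) (Fin d) ℝ) : matVec (c • A) = c • matVec A := rfl

theorem matVec_injective : Function.Injective (matVec (d := d)) := fun A B h => by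
  ext i j
  exact congrArg (fun v => v.ofLp (i, j)) h

theorem inner_matVec (A B : Matrix (Fin d) (Fin d) ℝ) :
    ⟪matVec A, matVec B⟫ = (A * Bᵀ).trace := by
  simp only [PiLp.inner_apply, Fintype.sum_prod_type, trace, diag, mul_apply, transpose_apply,
    matVec_apply]
  exact Finset.sum_congr rfl fun _ _ => Finset.sum_congr rfl fun _ _ => by simp [mul_comm]

theorem norm_matVec_sq (A : Matrix (Fin d) (Fin d) ℝ) :
    ‖matVec A‖ ^ 2 = ∑ i, ∑ j, A i j ^ 2 := by
  rw [EuclideanSpace.real_norm_sq_eq, Fintype.sum_prod_type]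
  rfl

theorem norm_matVec_eq_frobNorm (A : Matrix (Fin d) (Fin d) ℝ) : ‖matVec A‖ = frobNorm A := by
  rw [frobNorm, ← norm_matVec_sq, Real.sqrt_sq (norm_nonneg _)]

theorem norm_matVec_transpose (A : Matrix (Fin d) (Fin d) ℝ) : ‖matVec Aᵀ‖ = ‖matVec A‖ := by
  rw [← sq_eq_sq₀ (norm_nonneg _) (norm_nonneg _), norm_matVec_sq, norm_matVec_sq, Finset.sum_comm]
  rfl

theorem norm_matVec_mul_le (A B : Matrix (Fin d) (Fin d) ℝ) :
    ‖matVec (A * B)‖ ≤ ‖matVec A‖ * ‖matVec B‖ := by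
  refine le_of_sq_le_sq ?_ (by positivity)
  rw [mul_pow, norm_matVec_sq, norm_matVec_sq, norm_matVec_sq, Finset.sum_comm (γ := Fin d)
    (f := fun i j => B i j ^ 2), Finset.sum_mul_sum]
  refine Finset.sum_le_sum fun i _ => Finset.sum_le_sum fun j _ => ?_
  rw [mul_apply]
  exact Finset.sum_mul_sq_le_sq_mul_sq _ _ _

/-- The operator norm bound is applied to each column of `B`. -/
theorem norm_matVec_mul_le_opNorm (A B : Matrix (Fin d) (Fin d) ℝ) :
    ‖matVec (A * B)‖ ≤ opNorm A * ‖matVec B‖ := by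
  have h0 : 0 ≤ opNorm A := norm_nonneg _
  refine le_of_sq_le_sq ?_ (by positivity)
  rw [mul_pow, norm_matVec_sq, norm_matVec_sq, Finset.sum_comm, Finset.sum_comm (γ := Fin d)
    (f := fun i j => B i j ^ 2), Finset.mul_sum]
  refine Finset.sum_le_sum fun j _ => ?_
  have h := (Matrix.toEuclideanCLM (𝕜 := ℝ) A).le_opNorm (WithLp.toLp 2 fun i => B i j)
  have h2 := pow_le_pow_left₀ (norm_nonneg _) h 2
  rw [mul_pow, EuclideanSpace.real_norm_sq_eq, EuclideanSpace.real_norm_sq_eq] at h2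
  exact h2

/-- With `R = √M`, the form is `‖R x‖²`, and `‖x‖ ≤ ‖R⁻¹‖ ‖R x‖`. -/
theorem exists_coercive_of_posDef {n : Type*} [Fintype n] [DecidableEq n] {M : Matrix n n ℝ}
    (hM : M.PosDef) : ∃ k : ℝ, 0 < k ∧ ∀ x : EuclideanSpace ℝ n,
      ‖x‖ ^ 2 ≤ k * ⟪Matrix.toEuclideanCLM (𝕜 := ℝ) M x, x⟫ := by
  open scoped MatrixOrder in
  have hRR : CFC.sqrt M * CFC.sqrt M = M := CFC.sqrt_mul_sqrt_self _ hM.posSemidef.nonneg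
  open scoped MatrixOrder in
  have hRsa : IsSelfAdjoint (CFC.sqrt M) := (CFC.sqrt_nonneg M).isSelfAdjoint
  set R := CFC.sqrt M
  have hRdet : IsUnit R.det := by
    have := hM.det_pos.ne'
    rw [← hRR, det_mul] at this
    exact (left_ne_zero_of_mul this).isUnit
  set P := Matrix.toEuclideanCLM (𝕜 := ℝ) R with hP
  set Q := Matrix.toEuclideanCLM (𝕜 := ℝ) R⁻¹ with hQ
  have hQP : Q * P = 1 := by
    rw [hQ, hP, ← map_mul, nonsing_inv_mul _ hRdet, map_one]
  have hPP : Matrix.toEuclideanCLM (𝕜 := ℝ) M = P * P := by rw [hP, ← map_mul, hRR]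
  have hPsymm := (ContinuousLinearMap.isSelfAdjoint_iff_isSymmetric.1 (hRsa.map
    (Matrix.toEuclideanCLM (𝕜 := ℝ) (n := n))))
  -- The `+ 1` keeps the constant positive even over an empty index type, where `‖Q‖ = 0`.
  refine ⟨‖Q‖ ^ 2 + 1, by positivity, fun x => ?_⟩
  have h1 : ⟪Matrix.toEuclideanCLM (𝕜 := ℝ) M x, x⟫ = ‖P x‖ ^ 2 := by
    rw [hPP, ← real_inner_self_eq_norm_sq]
    exact hPsymm (P x) x
  have h2 : ‖x‖ ≤ ‖Q‖ * ‖P x‖ := by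
    have : Q (P x) = x := congrArg (fun L => L x) hQP
    calc ‖x‖ = ‖Q (P x)‖ := by rw [this]
      _ ≤ _ := Q.le_opNorm _
  rw [h1]
  calc ‖x‖ ^ 2 ≤ (‖Q‖ * ‖P x‖) ^ 2 := by gcongr
    _ = ‖Q‖ ^ 2 * ‖P x‖ ^ 2 := mul_pow _ _ _
    _ ≤ _ := by gcongr; linarith

end MatrixNorm

/-! ### The Hessian and the initial loss -/

section Curvature

open scoped RealInnerProductSpace

variable {d T : ℕ} {Λ : Matrix (Fin d) (Fin d) ℝ}

theorem posDef_Gam (hT : 0 < T) (hΛ : Λ.PosDef) : (Gam Λ T).PosDef := by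
  refine (hΛ.smul (by positivity)).add_posSemidef (PosSemidef.one.smul ?_)
  have := hΛ.posSemidef.trace_nonneg
  positivity

theorem mul_Gam_comm : Λ * Gam Λ T = Gam Λ T * Λ := by
  simp [Gam, Matrix.mul_add, Matrix.add_mul]

/-- `Γ` is affine in `Λ`, so the product is a combination of `Λ²` and `Λ` with positive and
nonnegative coefficients. -/
theorem posDef_mul_Gam (hT : 0 < T) (hΛ : Λ.PosDef) : (Λ * Gam Λ T).PosDef := by
  have h1 : (Λ * Λ).PosDef := by
    have h := PosDef.conjTranspose_mul_self Λ (mulVec_injective_iff_isUnit.2 hΛ.isUnit)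
    rwa [hΛ.1.eq] at h
  have h2 : Λ * Gam Λ T = (1 + 1 / (T : ℝ)) • (Λ * Λ) + (1 / (T : ℝ) * Λ.trace) • Λ := by
    simp [Gam, Matrix.mul_add]
  rw [h2]
  refine (h1.smul (by positivity)).add_posSemidef (hΛ.posSemidef.smul ?_)
  have := hΛ.posSemidef.trace_nonneg
  positivity

/-- The Hessian of the population loss as a function of the product of the value entry and the
key-query block: the operator `A ↦ ΛΓ A Λ`. -/
noncomputable def curvature (Λ : Matrix (Fin d) (Fin d) ℝ) (T : ℕ) :
    EuclideanSpace ℝ (Fin d × Fin d) →L[ℝ] EuclideanSpace ℝ (Fin d × Fin d) :=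
  Matrix.toEuclideanCLM (𝕜 := ℝ) (kroneckerMap (· * ·) (Λ * Gam Λ T) Λ)

theorem curvature_matVec (hΛ : Λ.PosDef) (A : Matrix (Fin d) (Fin d) ℝ) :
    curvature Λ T (matVec A) = matVec (Λ * Gam Λ T * A * Λ) := by
  have hsymm : ∀ i j, Λ i j = Λ j i := fun i j => by
    have := hΛ.1.apply i j; simpa using this.symm
  ext ⟨i, j⟩
  change ∑ p : Fin d × Fin d, (Λ * Gam Λ T) i p.1 * Λ j p.2 * A p.1 p.2 = _
  rw [Fintype.sum_prod_type, Finset.sum_comm, matVec_apply, mul_apply]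
  refine Finset.sum_congr rfl fun l _ => ?_
  rw [mul_apply, Finset.sum_mul]
  exact Finset.sum_congr rfl fun k _ => by rw [hsymm j l]; ring

theorem posDef_kronecker_mul_Gam (hT : 0 < T) (hΛ : Λ.PosDef) :
    (kroneckerMap (· * ·) (Λ * Gam Λ T) Λ).PosDef := (posDef_mul_Gam hT hΛ).kronecker hΛ

theorem curvature_symm (hT : 0 < T) (hΛ : Λ.PosDef) (x y : EuclideanSpace ℝ (Fin d × Fin d)) :
    ⟪curvature Λ T x, y⟫ = ⟪x, curvature Λ T y⟫ := by
  have h : IsSelfAdjoint (kroneckerMap (· * ·) (Λ * Gam Λ T) Λ) :=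
    (posDef_kronecker_mul_Gam hT hΛ).1
  exact ContinuousLinearMap.isSelfAdjoint_iff_isSymmetric.1 (h.map
    (Matrix.toEuclideanCLM (𝕜 := ℝ) (n := Fin d × Fin d))) x y

theorem curvature_matVec_inv_Gam (hT : 0 < T) (hΛ : Λ.PosDef) :
    curvature Λ T (matVec (Gam Λ T)⁻¹) = matVec (Λ * Λ) := by
  rw [curvature_matVec hΛ, mul_nonsing_inv_cancel_right _ _
    ((isUnit_iff_isUnit_det _).1 (posDef_Gam hT hΛ).isUnit)]

theorem inner_curvature_matVec_self (hΛ : Λ.PosDef) (A : Matrix (Fin d) (Fin d) ℝ) :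
    ⟪curvature Λ T (matVec A), matVec A⟫ = (Λ * Gam Λ T * (A * Λ * Aᵀ)).trace := by
  rw [curvature_matVec hΛ, inner_matVec]
  simp only [Matrix.mul_assoc]

theorem inner_curvature_inv_Gam (hT : 0 < T) (hΛ : Λ.PosDef) (A : Matrix (Fin d) (Fin d) ℝ) :
    ⟪curvature Λ T (matVec (Gam Λ T)⁻¹), matVec A⟫ = (Λ * (A * Λ)).trace := by
  have hΛt : Λᵀ = Λ := by simpa using hΛ.1.eq
  rw [curvature_matVec_inv_Gam hT hΛ, inner_matVec, ← trace_transpose]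
  simp only [transpose_mul, transpose_transpose, hΛt]
  rw [← Matrix.mul_assoc, trace_mul_comm]

/-- Completing the square: the linear term of the loss is the pairing with `K Γ⁻¹`, which makes
`Γ⁻¹` the optimal predictor. -/
theorem inner_curvature_sub (hT : 0 < T) (hΛ : Λ.PosDef) (s : ℝ) (A : Matrix (Fin d) (Fin d) ℝ) :
    ⟪curvature Λ T (s • matVec A - matVec (Gam Λ T)⁻¹), s • matVec A - matVec (Gam Λ T)⁻¹⟫ =
      s ^ 2 * (Λ * Gam Λ T * (A * Λ * Aᵀ)).trace - 2 * s * (Λ * (A * Λ)).trace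
        + ⟪curvature Λ T (matVec (Gam Λ T)⁻¹), matVec (Gam Λ T)⁻¹⟫ := by
  rw [← inner_curvature_matVec_self hΛ, ← inner_curvature_inv_Gam hT hΛ]
  simp only [map_sub, map_smul, inner_sub_left, inner_sub_right, real_inner_smul_left,
    real_inner_smul_right]
  rw [curvature_symm hT hΛ (matVec A) (matVec (Gam Λ T)⁻¹),
    real_inner_comm (curvature Λ T (matVec (Gam Λ T)⁻¹)) (matVec A)]
  ring

/-- The small initialization has a smaller loss than the zero parameter. -/
theorem initial_loss_lt (hT : 0 < T) (hΛ : Λ.PosDef) {σ : ℝ} (hσ : 0 < σ)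
    {Θ : Matrix (Fin d) (Fin d) ℝ} (hΘ : frobNorm (Θ * Θᵀ) = 1) (hΘΛ : Θ * Λ ≠ 0)
    (hσΓ : σ ^ 2 * opNorm (Gam Λ T) * √(d : ℝ) < 2) :
    ⟪curvature Λ T (σ • matVec (σ • (Θ * Θᵀ)) - matVec (Gam Λ T)⁻¹),
      σ • matVec (σ • (Θ * Θᵀ)) - matVec (Gam Λ T)⁻¹⟫ <
    ⟪curvature Λ T (matVec (Gam Λ T)⁻¹), matVec (Gam Λ T)⁻¹⟫ := by
  have hΛt : Λᵀ = Λ := by simpa using hΛ.1.eq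
  have hd : 0 < d := by
    rcases Nat.eq_zero_or_pos d with rfl | h
    · exact absurd (Subsingleton.elim _ _) hΘΛ
    · exact h
  have hop : 0 ≤ opNorm (Gam Λ T) := norm_nonneg _
  have hσΓ' : σ ^ 2 * opNorm (Gam Λ T) < 2 := by
    have h1 : (1 : ℝ) ≤ √(d : ℝ) := Real.one_le_sqrt.2 (by exact_mod_cast hd)
    have h2 : 0 ≤ σ ^ 2 * opNorm (Gam Λ T) := by positivity
    nlinarith
  set Y := Λ * Θ with hY
  have hYpos : 0 < ‖matVec Y‖ ^ 2 := by
    have : Y ≠ 0 := by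
      intro h
      apply hΘΛ
      have h3 : Θ = 0 := by
        have := congrArg (fun X => Λ⁻¹ * X) h
        rwa [hY, nonsing_inv_mul_cancel_left _ _ ((isUnit_iff_isUnit_det _).1 hΛ.isUnit),
          Matrix.mul_zero] at this
      rw [h3, Matrix.zero_mul]
    have h0 : matVec Y ≠ 0 := fun h => this (matVec_injective h)
    positivity
  have hlin : (Λ * (Θ * Θᵀ * Λ)).trace = ‖matVec Y‖ ^ 2 := by
    rw [← real_inner_self_eq_norm_sq, inner_matVec, hY, transpose_mul, hΛt]
    simp only [Matrix.mul_assoc]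
  -- Moving one `Θ` across the trace gives `⟪Y ΘᵀΘ, Y⟫`, and `ΘᵀΘ` has the same Frobenius norm `1`
  -- as `ΘΘᵀ`.
  have hX : ‖matVec (Y * Θᵀ)‖ ^ 2 ≤ ‖matVec Y‖ ^ 2 := by
    have hn : ‖matVec (Θᵀ * Θ)‖ = 1 := by
      rw [← hΘ, ← norm_matVec_eq_frobNorm, ← sq_eq_sq₀ (norm_nonneg _) (norm_nonneg _),
        ← real_inner_self_eq_norm_sq, ← real_inner_self_eq_norm_sq, inner_matVec, inner_matVec]
      simp only [transpose_mul, transpose_transpose]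
      rw [Matrix.mul_assoc, trace_mul_comm]
      simp only [Matrix.mul_assoc]
    calc ‖matVec (Y * Θᵀ)‖ ^ 2 = ⟪matVec (Y * (Θᵀ * Θ)), matVec Y⟫ := by
          rw [← real_inner_self_eq_norm_sq, inner_matVec, inner_matVec, transpose_mul,
            transpose_transpose]
          simp only [Matrix.mul_assoc]
      _ ≤ ‖matVec (Y * (Θᵀ * Θ))‖ * ‖matVec Y‖ := real_inner_le_norm _ _
      _ ≤ ‖matVec Y‖ * ‖matVec (Θᵀ * Θ)‖ * ‖matVec Y‖ := by
          gcongr; exact norm_matVec_mul_le _ _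
      _ = ‖matVec Y‖ ^ 2 := by rw [hn]; ring
  have hquad : (Λ * Gam Λ T * (Θ * Θᵀ * Λ * (Θ * Θᵀ)ᵀ)).trace ≤
      opNorm (Gam Λ T) * ‖matVec Y‖ ^ 2 := by
    have e : (Λ * Gam Λ T * (Θ * Θᵀ * Λ * (Θ * Θᵀ)ᵀ)).trace =
        ⟪matVec (Gam Λ T * (Y * Θᵀ)), matVec (Y * Θᵀ)ᵀ⟫ := by
      rw [inner_matVec, transpose_transpose, hY, mul_Gam_comm, transpose_mul, transpose_transpose]
      simp only [Matrix.mul_assoc]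
    rw [e]
    calc _ ≤ ‖matVec (Gam Λ T * (Y * Θᵀ))‖ * ‖matVec (Y * Θᵀ)ᵀ‖ := real_inner_le_norm _ _
      _ ≤ opNorm (Gam Λ T) * ‖matVec (Y * Θᵀ)‖ * ‖matVec (Y * Θᵀ)‖ := by
          rw [norm_matVec_transpose]
          gcongr; exact norm_matVec_mul_le_opNorm _ _
      _ = opNorm (Gam Λ T) * ‖matVec (Y * Θᵀ)‖ ^ 2 := by ring
      _ ≤ _ := by gcongr
  rw [matVec_smul, smul_smul, inner_curvature_sub hT hΛ, hlin]
  -- The effective scale is `σ · σ`, so the quadratic term carries `σ⁴` and the linear one `2σ²`;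
  -- strictness comes from `ΛΘ ≠ 0`.
  have h4 : σ ^ 2 * (σ ^ 2 * (Λ * Gam Λ T * (Θ * Θᵀ * Λ * (Θ * Θᵀ)ᵀ)).trace) <
      σ ^ 2 * (2 * ‖matVec Y‖ ^ 2) := by
    refine mul_lt_mul_of_pos_left ?_ (by positivity)
    calc σ ^ 2 * (Λ * Gam Λ T * (Θ * Θᵀ * Λ * (Θ * Θᵀ)ᵀ)).trace
        ≤ σ ^ 2 * (opNorm (Gam Λ T) * ‖matVec Y‖ ^ 2) := by gcongr
      _ = σ ^ 2 * opNorm (Gam Λ T) * ‖matVec Y‖ ^ 2 := by ring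
      _ < 2 * ‖matVec Y‖ ^ 2 := by gcongr
  linarith

end Curvature
-- The limit of pretraining
section Pretraining

open scoped RealInnerProductSpace

variable {d T : ℕ} {Λ : Matrix (Fin d) (Fin d) ℝ}

/-- The value entry in the label row and column. -/
noncomputable def valueEntry (d : ℕ) : Params d →L[ℝ] ℝ :=
  EuclideanSpace.proj (Sum.inr (Sum.inr (), Sum.inr ()))

/-- The covariate block of the key-query matrix, as a vector. -/
noncomputable def keyBlock (d : ℕ) : Params d →L[ℝ] EuclideanSpace ℝ (Fin d × Fin d) :=
  (EuclideanSpace.equiv (Fin d × Fin d) ℝ).symm.toContinuousLinearMap.comp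
    (ContinuousLinearMap.pi fun p : Fin d × Fin d =>
      EuclideanSpace.proj (Sum.inl (Sum.inl p.1, Sum.inl p.2)))

theorem valueEntry_apply (θ : Params d) :
    valueEntry d θ = θ (Sum.inr (Sum.inr (), Sum.inr ())) := rfl

theorem keyBlock_apply (θ : Params d) (p : Fin d × Fin d) :
    keyBlock d θ p = θ (Sum.inl (Sum.inl p.1, Sum.inl p.2)) := rfl

theorem keyBlock_eq_matVec (θ : Params d) : keyBlock d θ = matVec θ.KQ.toBlocks₁₁ := rfl

/-- The deviation of the effective linear predictor from its optimum `Γ⁻¹`. -/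
noncomputable def deviation (Λ : Matrix (Fin d) (Fin d) ℝ) (T : ℕ) (θ : Params d) :
    EuclideanSpace ℝ (Fin d × Fin d) :=
  valueEntry d θ • keyBlock d θ - matVec (Gam Λ T)⁻¹

theorem apply_eq_zero_of_signFlip_eq {θ : Params d} (hθ : signFlip d θ = θ) {p}
    (hp : isOffDiag p = true) : θ p = 0 := by
  have h := congrArg (fun v : Params d => v p) hθ
  simp only [signFlip_apply, hp, if_true] at h
  linarith

theorem populationLoss_of_signFlip_eq (hT : 0 < T) (hΛ : Λ.PosDef) {θ : Params d}
    (hθ : signFlip d θ = θ) :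
    populationLoss Λ T θ = (1 / 2) * (⟪curvature Λ T (deviation Λ T θ), deviation Λ T θ⟫ +
      (Λ.trace - ⟪curvature Λ T (matVec (Gam Λ T)⁻¹), matVec (Gam Λ T)⁻¹⟫)) := by
  rw [populationLoss_of_block hT hΛ.posSemidef
    (fun a => apply_eq_zero_of_signFlip_eq hθ (p := Sum.inr (Sum.inr (), Sum.inl a)) rfl)
    (fun c => apply_eq_zero_of_signFlip_eq hθ (p := Sum.inl (Sum.inr (), Sum.inl c)) rfl),
    deviation, keyBlock_eq_matVec, inner_curvature_sub hT hΛ]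
  have hs : valueEntry d θ = θ.PV (Sum.inr ()) (Sum.inr ()) := rfl
  rw [hs]
  ring

/-- The gradient of the population loss at a block diagonal parameter, in a block diagonal
direction. -/
theorem fderiv_populationLoss (hT : 0 < T) (hΛ : Λ.PosDef) {θ v : Params d}
    (hθ : signFlip d θ = θ) (hv : signFlip d v = v) :
    fderiv ℝ (populationLoss Λ T) θ v = ⟪curvature Λ T (deviation Λ T θ),
      valueEntry d v • keyBlock d θ + valueEntry d θ • keyBlock d v⟫ := by
  have hF : Differentiable ℝ (populationLoss Λ T) :=
    (contDiff_populationLoss (n := 1)).differentiable one_ne_zero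
  -- The line `θ + ε v` stays in the fixed space of the reflection, where the quadratic formula for
  -- the loss is available.
  have hline : HasDerivAt (fun ε : ℝ => θ + ε • v) v 0 := by
    simpa using ((hasDerivAt_id' (0 : ℝ)).smul_const v).const_add θ
  have h1 : HasDerivAt (fun ε : ℝ => populationLoss Λ T (θ + ε • v))
      (fderiv ℝ (populationLoss Λ T) θ v) 0 := by
    have h0 : HasFDerivAt (populationLoss Λ T) (fderiv ℝ (populationLoss Λ T) θ)
        (θ + (0 : ℝ) • v) := by
      rw [zero_smul, add_zero]; exact (hF θ).hasFDerivAt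
    exact h0.comp_hasDerivAt 0 hline
  have hdev : HasDerivAt (fun ε : ℝ => deviation Λ T (θ + ε • v))
      (valueEntry d θ • keyBlock d v + valueEntry d v • keyBlock d θ) 0 := by
    have hs := (valueEntry d).hasFDerivAt.comp_hasDerivAt (0 : ℝ) hline
    have hA := (keyBlock d).hasFDerivAt.comp_hasDerivAt (0 : ℝ) hline
    have h := (hs.smul hA).sub_const (matVec (Gam Λ T)⁻¹)
    exact h.congr_deriv (by simp)
  have h2 : HasDerivAt (fun ε : ℝ => populationLoss Λ T (θ + ε • v))
      ⟪curvature Λ T (deviation Λ T θ),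
        valueEntry d v • keyBlock d θ + valueEntry d θ • keyBlock d v⟫ 0 := by
    have heq : (fun ε : ℝ => populationLoss Λ T (θ + ε • v)) = fun ε : ℝ => (1 / 2) *
        (⟪curvature Λ T (deviation Λ T (θ + ε • v)), deviation Λ T (θ + ε • v)⟫ +
        (Λ.trace - ⟪curvature Λ T (matVec (Gam Λ T)⁻¹), matVec (Gam Λ T)⁻¹⟫)) := by
      funext ε
      exact populationLoss_of_signFlip_eq hT hΛ (by rw [map_add, map_smul, hθ, hv])
    rw [heq]
    refine ((((curvature Λ T).hasFDerivAt.comp_hasDerivAt (0 : ℝ) hdev).inner ℝ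
      hdev).add_const _ |>.const_mul (1 / 2)).congr_deriv ?_
    simp only [Function.comp, zero_smul, add_zero]
    rw [curvature_symm hT hΛ (_ + _), real_inner_comm (curvature Λ T (deviation Λ T θ)),
      add_comm (valueEntry d v • _)]
    ring
  exact h1.unique h2

variable {θ : ℝ → Params d}

/-- Block diagonality is preserved by the gradient flow. -/
theorem signFlip_eq_of_gradientFlow (hθ0 : signFlip d (θ 0) = θ 0)
    (hθ : IsGradientFlow (populationLoss Λ T) θ) {t : ℝ} (ht : 0 ≤ t) :
    signFlip d (θ t) = θ t := by
  have hF := contDiff_populationLoss (Λ := Λ) (T := T) (n := 2)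
  refine eq_of_hasDerivWithinAt_autonomous (v := fun x => -gradient (populationLoss Λ T) x)
    (f := fun t => signFlip d (θ t)) (contDiff_gradient hF).neg (fun t ht => ?_) hθ hθ0 ht
  have h := (signFlip d).toContinuousLinearEquiv.toContinuousLinearMap.hasFDerivAt.comp_hasDerivWithinAt
    t (hθ t ht)
  refine h.congr_deriv ?_
  rw [gradient_apply_of_invariant (hF.differentiable two_ne_zero) (populationLoss_signFlip Λ T),
    ← map_neg]
  rfl

theorem signFlip_single {p} (hp : isOffDiag p = false) :
    signFlip d (EuclideanSpace.single p 1) = EuclideanSpace.single p 1 := by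
  ext q
  rw [signFlip_apply]
  split_ifs with hq
  · have : q ≠ p := fun h => by rw [h, hp] at hq; exact Bool.false_ne_true hq
    simp [this]
  · rfl

/-- A gradient coordinate is the derivative along a basis vector; for `p` in a diagonal block this
direction is fixed by the reflection, so the restricted loss determines it. -/
theorem hasDerivWithinAt_coord (hT : 0 < T) (hΛ : Λ.PosDef) (hθ0 : signFlip d (θ 0) = θ 0)
    (hθ : IsGradientFlow (populationLoss Λ T) θ) {p} (hp : isOffDiag p = false)
    {t : ℝ} (ht : 0 ≤ t) :
    HasDerivWithinAt (fun t => θ t p) (-⟪curvature Λ T (deviation Λ T (θ t)),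
      valueEntry d (EuclideanSpace.single p 1) • keyBlock d (θ t) +
        valueEntry d (θ t) • keyBlock d (EuclideanSpace.single p 1)⟫) (Set.Ici 0) t := by
  have h := (EuclideanSpace.proj p : Params d →L[ℝ] ℝ).hasFDerivAt.comp_hasDerivWithinAt
    t (hθ t ht)
  refine h.congr_deriv ?_
  rw [← fderiv_populationLoss hT hΛ (signFlip_eq_of_gradientFlow hθ0 hθ ht) (signFlip_single hp),
    ← inner_gradient_left, EuclideanSpace.inner_single_right]
  simp

theorem hasDerivWithinAt_valueEntry (hT : 0 < T) (hΛ : Λ.PosDef) (hθ0 : signFlip d (θ 0) = θ 0)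
    (hθ : IsGradientFlow (populationLoss Λ T) θ) {t : ℝ} (ht : 0 ≤ t) :
    HasDerivWithinAt (fun t => valueEntry d (θ t))
      (-⟪curvature Λ T (deviation Λ T (θ t)), keyBlock d (θ t)⟫) (Set.Ici 0) t := by
  refine (hasDerivWithinAt_coord hT hΛ hθ0 hθ (p := Sum.inr (Sum.inr (), Sum.inr ())) rfl
    ht).congr_deriv ?_
  have h1 : valueEntry d (EuclideanSpace.single (Sum.inr (Sum.inr (), Sum.inr ())) 1) = 1 := by
    simp [valueEntry_apply]
  have h2 : keyBlock d (EuclideanSpace.single (Sum.inr (Sum.inr (), Sum.inr ())) 1) = 0 := by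
    ext p; simp [keyBlock_apply]
  rw [h1, h2, one_smul, smul_zero, add_zero]

theorem hasDerivWithinAt_keyBlock (hT : 0 < T) (hΛ : Λ.PosDef) (hθ0 : signFlip d (θ 0) = θ 0)
    (hθ : IsGradientFlow (populationLoss Λ T) θ) {t : ℝ} (ht : 0 ≤ t) :
    HasDerivWithinAt (fun t => keyBlock d (θ t))
      (-(valueEntry d (θ t) • curvature Λ T (deviation Λ T (θ t)))) (Set.Ici 0) t := by
  rw [hasDerivWithinAt_iff_hasFDerivWithinAt, hasFDerivWithinAt_piLp]
  intro p
  refine HasDerivWithinAt.hasFDerivWithinAt ?_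
  refine (hasDerivWithinAt_coord hT hΛ hθ0 hθ (p := Sum.inl (Sum.inl p.1, Sum.inl p.2)) rfl
    ht).congr_deriv ?_
  have h1 : valueEntry d (EuclideanSpace.single (Sum.inl (Sum.inl p.1, Sum.inl p.2)) 1) = 0 := by
    simp [valueEntry_apply]
  have h2 : keyBlock d (EuclideanSpace.single (Sum.inl (Sum.inl p.1, Sum.inl p.2)) 1) =
      EuclideanSpace.single p 1 := by
    ext q
    simp [keyBlock_apply, Prod.ext_iff]
  rw [h1, h2, zero_smul, zero_add, real_inner_smul_right, EuclideanSpace.inner_single_right]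
  simp

/-- All entries outside the value entry and the covariate block are constant in time. -/
theorem coord_eq_of_gradientFlow (hT : 0 < T) (hΛ : Λ.PosDef) (hθ0 : signFlip d (θ 0) = θ 0)
    (hθ : IsGradientFlow (populationLoss Λ T) θ) {p}
    (hval : valueEntry d (EuclideanSpace.single p 1) = 0)
    (hkey : keyBlock d (EuclideanSpace.single p 1) = 0) {t : ℝ} (ht : 0 ≤ t) :
    θ t p = θ 0 p := by
  -- Off-diagonal entries vanish by symmetry; the remaining ones do not enter the restricted loss
  -- and have zero derivative.
  by_cases hp : isOffDiag p = true
  · rw [apply_eq_zero_of_signFlip_eq hθ0 hp,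
      apply_eq_zero_of_signFlip_eq (signFlip_eq_of_gradientFlow hθ0 hθ ht) hp]
  · refine eq_of_hasDerivWithinAt_Ici_zero (f := fun t => θ t p) (fun t ht => ?_) ht
    refine (hasDerivWithinAt_coord hT hΛ hθ0 hθ (Bool.not_eq_true _ ▸ hp) ht).congr_deriv ?_
    simp [hval, hkey]

/-- The pretrained parameter: it is block diagonal and its effective linear predictor is `Γ⁻¹`. -/
theorem exists_tendsto_gradientFlow (hT : 0 < T) (hΛ : Λ.PosDef) {σ : ℝ} (hσ : 0 < σ)
    {Θ : Matrix (Fin d) (Fin d) ℝ} (hΘ : frobNorm (Θ * Θᵀ) = 1) (hΘΛ : Θ * Λ ≠ 0)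
    (hσΓ : σ ^ 2 * opNorm (Gam Λ T) * √(d : ℝ) < 2) (hθ₀ : θ 0 = initParams σ Θ)
    (hθ : IsGradientFlow (populationLoss Λ T) θ) :
    ∃ θlim : Params d, Tendsto θ atTop (𝓝 θlim) ∧ (∀ a, θlim.PV (Sum.inr ()) (Sum.inl a) = 0) ∧
      (∀ c, θlim.KQ (Sum.inr ()) (Sum.inl c) = 0) ∧
      θlim.PV (Sum.inr ()) (Sum.inr ()) • θlim.KQ.toBlocks₁₁ = (Gam Λ T)⁻¹ := by
  have hflip0 : signFlip d (θ 0) = θ 0 := by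
    ext p
    rw [signFlip_apply, hθ₀]
    rcases p with ⟨a | a, b | b⟩ | ⟨a | a, b | b⟩ <;>
      simp [isOffDiag, initParams, Params.ofMatrices]
  have hval0 : valueEntry d (θ 0) = σ := by
    rw [hθ₀]; simp [valueEntry_apply, initParams, Params.ofMatrices]
  have hkey0 : keyBlock d (θ 0) = matVec (σ • (Θ * Θᵀ)) := by
    rw [hθ₀]; ext p; simp [keyBlock_apply, initParams, Params.ofMatrices]
  obtain ⟨k, hk, hcoer⟩ := exists_coercive_of_posDef (posDef_kronecker_mul_Gam hT hΛ)
  obtain ⟨A', s', hA', hs', hG⟩ := exists_tendsto_of_balanced_flow (curvature_symm hT hΛ) hk hcoer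
    (G := matVec (Gam Λ T)⁻¹) (A := fun t => keyBlock d (θ t)) (s := fun t => valueEntry d (θ t))
    (fun t ht => hasDerivWithinAt_keyBlock hT hΛ hflip0 hθ ht)
    (fun t ht => hasDerivWithinAt_valueEntry hT hΛ hflip0 hθ ht)
    (by rw [hval0]; exact hσ)
    (by rw [hval0, hkey0, matVec_smul, norm_smul, norm_matVec_eq_frobNorm, hΘ, mul_one,
      Real.norm_of_nonneg hσ.le])
    (by rw [hval0, hkey0]; exact initial_loss_lt hT hΛ hσ hΘ hΘΛ hσΓ)
  -- Convergence is checked entrywise: only the covariate block and the value entry move.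
  have hcoord : ∀ p, ∃ c, Tendsto (fun t => θ t p) atTop (𝓝 c) := by
    intro p
    have hconst : valueEntry d (EuclideanSpace.single p 1) = 0 →
        keyBlock d (EuclideanSpace.single p 1) = 0 → ∃ c, Tendsto (fun t => θ t p) atTop (𝓝 c) :=
      fun h1 h2 => ⟨θ 0 p, tendsto_const_nhds.congr' <| by
        filter_upwards [eventually_ge_atTop 0] with t ht
        exact (coord_eq_of_gradientFlow hT hΛ hflip0 hθ h1 h2 ht).symm⟩
    rcases p with ⟨a | a, b | b⟩ | ⟨a | a, b | b⟩
    · exact ⟨A' (a, b), ((EuclideanSpace.proj (a, b) :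
        EuclideanSpace ℝ (Fin d × Fin d) →L[ℝ] ℝ).continuous.tendsto A').comp hA'⟩
    all_goals first
      | exact ⟨s', hs'⟩
      | exact hconst (by simp [valueEntry_apply]) (by ext q; simp [keyBlock_apply])
  choose c hc using hcoord
  have hlim : Tendsto θ atTop (𝓝 (WithLp.toLp 2 c)) :=
    ((PiLp.continuous_toLp 2 _).tendsto c).comp (tendsto_pi_nhds.2 hc)
  have hflip : signFlip d (WithLp.toLp 2 c) = WithLp.toLp 2 c := by
    refine tendsto_nhds_unique (((signFlip d).continuous.tendsto _).comp hlim) (hlim.congr' ?_)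
    filter_upwards [eventually_ge_atTop 0] with t ht
    exact (signFlip_eq_of_gradientFlow hflip0 hθ ht).symm
  refine ⟨WithLp.toLp 2 c, hlim,
    fun a => apply_eq_zero_of_signFlip_eq hflip (p := Sum.inr (Sum.inr (), Sum.inl a)) rfl,
    fun a => apply_eq_zero_of_signFlip_eq hflip (p := Sum.inl (Sum.inr (), Sum.inl a)) rfl,
    matVec_injective ?_⟩
  rw [matVec_smul, ← keyBlock_eq_matVec, ← hG,
    ← tendsto_nhds_unique (((keyBlock d).continuous.tendsto _).comp hlim) hA',
    ← tendsto_nhds_unique (((valueEntry d).continuous.tendsto _).comp hlim) hs']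
  rfl

end Pretraining

/-! ### One Fed-ICL round as an affine map -/

section Rounds

variable {d : ℕ} {θ : Params d} {Γ : Matrix (Fin d) (Fin d) ℝ}

/-- A block diagonal model with effective linear predictor `Γ⁻¹` predicts the inner product of the
query with `Γ⁻¹` applied to the average of the label-weighted covariates. -/
theorem icl_eq_of_block {ι : Type*} [Fintype ι]
    (hPV : ∀ a, θ.PV (Sum.inr ()) (Sum.inl a) = 0) (hKQ : ∀ c, θ.KQ (Sum.inr ()) (Sum.inl c) = 0)
    (hΓ : θ.PV (Sum.inr ()) (Sum.inr ()) • θ.KQ.toBlocks₁₁ = Γ⁻¹) (hsymm : Γ⁻¹ᵀ = Γ⁻¹)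
    (ex : ι → (Fin d → ℝ) × ℝ) (xq : Fin d → ℝ) :
    icl θ ex xq = (Γ⁻¹ *ᵥ ((Fintype.card ι : ℝ)⁻¹ • ∑ i, (ex i).2 • (ex i).1)) ⬝ᵥ xq := by
  rw [icl_of_block hPV hKQ, hΓ, mulVec_smul, smul_dotProduct, smul_eq_mul, dotProduct_mulVec,
    ← mulVec_transpose, hsymm]

/-- Linear labels turn the label-weighted sum into a second moment matrix; this produces both Gram
factors of `Hcont`. -/
theorem sum_dotProduct_smul {ι : Type*} [Fintype ι] (x : ι → Fin d → ℝ) (u : Fin d → ℝ) :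
    ∑ i, (u ⬝ᵥ x i) • x i = (∑ i, vecMulVec (x i) (x i)) *ᵥ u := by
  rw [sum_mulVec]
  refine Finset.sum_congr rfl fun i _ => ?_
  rw [vecMulVec_mulVec, dotProduct_comm]
  simp

variable {L N M : ℕ}

theorem fedRound_eq (hL : 0 < L) (hN : 0 < N) (hM : 0 < M)
    (hicl : ∀ {ι : Type} [Fintype ι] (ex : ι → (Fin d → ℝ) × ℝ) (xq : Fin d → ℝ),
      icl θ ex xq = (Γ⁻¹ *ᵥ ((Fintype.card ι : ℝ)⁻¹ • ∑ i, (ex i).2 • (ex i).1)) ⬝ᵥ xq)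
    (D : Fin L → Fin N → (Fin d → ℝ) × ℝ) (x : Fin M → Fin d → ℝ) (w : Fin d → ℝ) (m : Fin M) :
    fedRound θ D x (fun m => w ⬝ᵥ x m) m =
      ((1 / 2 : ℝ) • (Hcont Γ D x *ᵥ w) + (1 / 2 : ℝ) • wLimit Γ D) ⬝ᵥ x m := by
  have hL' : (L : ℝ) ≠ 0 := by positivity
  have hN' : (N : ℝ) ≠ 0 := by positivity
  have hM' : (M : ℝ) ≠ 0 := by positivity
  -- The weight vector with which every client relabels its own covariates; it does not depend on
  -- the client.
  set u : Fin d → ℝ := Γ⁻¹ *ᵥ ((M : ℝ)⁻¹ • ((∑ m, vecMulVec (x m) (x m)) *ᵥ w)) with hu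
  have hrelabel (i : Fin L) (n : Fin N) :
      relabel θ (D i) (fun m => (x m, w ⬝ᵥ x m)) n = ((D i n).1, u ⬝ᵥ (D i n).1) := by
    rw [relabel, hicl, hu, ← sum_dotProduct_smul, Fintype.card_fin]
  -- True and predicted labels share the normalization `2N`, the source of the two factors `1/2`.
  have hans (i : Fin L) : clientAnswer θ (D i) (fun m => (x m, w ⬝ᵥ x m)) m =
      (Γ⁻¹ *ᵥ ((2 * (N : ℝ))⁻¹ • (∑ n, (D i n).2 • (D i n).1 +
        (∑ n, vecMulVec (D i n).1 (D i n).1) *ᵥ u))) ⬝ᵥ x m := by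
    rw [clientAnswer, hicl, Fintype.sum_sum_type]
    simp only [Sum.elim_inl, Sum.elim_inr, hrelabel, Fintype.card_sum, Fintype.card_fin,
      sum_dotProduct_smul (fun n => (D i n).1)]
    push_cast
    rw [two_mul]
  rw [fedRound]
  simp only [hans]
  rw [← sum_dotProduct, ← mulVec_sum, ← Finset.smul_sum, Finset.sum_add_distrib, ← sum_mulVec,
    ← smul_eq_mul, ← smul_dotProduct]
  congr 1
  rw [Hcont, wLimit, hu]
  simp only [mulVec_add, mulVec_smul, smul_add, smul_smul, smul_mulVec, mulVec_mulVec]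
  rw [add_comm]
  simp only [Matrix.mul_assoc]
  congr 2 <;> field_simp

end Rounds
end FedICL

/-! ### The main theorem -/

theorem theorem1 {d T : ℕ} (hT : 0 < T)
    (Λ : Matrix (Fin d) (Fin d) ℝ) (hΛ : Λ.PosDef)
    (σ : ℝ) (hσ : 0 < σ)
    (Θ : Matrix (Fin d) (Fin d) ℝ) (hΘ : FedICL.frobNorm (Θ * Θᵀ) = 1) (hΘΛ : Θ * Λ ≠ 0)
    (hσΓ : σ ^ 2 * FedICL.opNorm (FedICL.Gam Λ T) * √(d : ℝ) < 2)
    (θ : ℝ → FedICL.Params d) (hθ₀ : θ 0 = FedICL.initParams σ Θ)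
    (hθ : FedICL.IsGradientFlow (FedICL.populationLoss Λ T) θ) :
    ∃ θlim : FedICL.Params d, Tendsto θ atTop (𝓝 θlim) ∧
      ∀ {L N M : ℕ}, 0 < L → 0 < N → 0 < M →
      ∀ (D : Fin L → Fin N → (Fin d → ℝ) × ℝ) (x : Fin M → Fin d → ℝ),
        (∃ w : ℕ → Fin d → ℝ, w 0 = 0 ∧
          (∀ k : ℕ, ∀ m : Fin M, FedICL.serverLabels θlim D x k m = w k ⬝ᵥ x m) ∧
          (∀ k : ℕ, w (k + 1) =
            (1 / 2 : ℝ) • (FedICL.Hcont (FedICL.Gam Λ T) D x *ᵥ w k) +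
              (1 / 2 : ℝ) • FedICL.wLimit (FedICL.Gam Λ T) D)) ∧
        (∀ xq : Fin d → ℝ,
          FedICL.icl θlim (FedICL.pooled D) xq = FedICL.wLimit (FedICL.Gam Λ T) D ⬝ᵥ xq) := by
  obtain ⟨θlim, hlim, hPV, hKQ, hΓ⟩ :=
    FedICL.exists_tendsto_gradientFlow hT hΛ hσ hΘ hΘΛ hσΓ hθ₀ hθ
  have hsymm : (FedICL.Gam Λ T)⁻¹ᵀ = (FedICL.Gam Λ T)⁻¹ := by
    simpa using (FedICL.posDef_Gam hT hΛ).inv.1.eq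
  refine ⟨θlim, hlim, fun {L N M} hL hN hM D x => ⟨?_, fun xq => ?_⟩⟩
  · let w : ℕ → Fin d → ℝ := fun k => Nat.rec 0 (fun _ v =>
      (1 / 2 : ℝ) • (FedICL.Hcont (FedICL.Gam Λ T) D x *ᵥ v) +
        (1 / 2 : ℝ) • FedICL.wLimit (FedICL.Gam Λ T) D) k
    refine ⟨w, rfl, fun k => ?_, fun k => rfl⟩
    induction k with
    | zero =>
      intro m
      exact (zero_dotProduct (x m)).symm
    | succ k ih =>
      intro m
      rw [FedICL.serverLabels, funext ih]
      exact FedICL.fedRound_eq hL hN hM (FedICL.icl_eq_of_block hPV hKQ hΓ hsymm) D x (w k) m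
  · rw [FedICL.icl_eq_of_block hPV hKQ hΓ hsymm, FedICL.wLimit]
    simp only [FedICL.pooled, Fintype.sum_prod_type, Fintype.card_prod, Fintype.card_fin]
    push_cast
    rw [one_div, mul_comm (L : ℝ)]
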